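/- Let $\alpha>-1$ and $\beta,\eta>0$ be real numbers, let $\mathbb{H}$ be the algebra of real quaternions, let $I\in\mathbb{H}$ with $I^2=-1$, and let $\mathbb{C}_I=\mathbb{R}+I\mathbb{R}$ and $\mathbb{B}_I=\{q\in\mathbb{C}_I: |q|<1\}$. Let $L^{2,\alpha}_{\mathbb{H}}(\mathbb{R}^+)=L^2\big((0,\infty),x^\alpha e^{-x}dx;\mathbb{H}\big)$ and $L^{2,\omega_{\beta,\eta}}_{\mathbb{H}}(\mathbb{B}_I)=L^2\big(\mathbb{B}_I,\omega_{\beta,\eta}(|q|^2)\,du\,dv;\mathbb{H}\big)$, where $q=u+Iv$ and $\omega_{\beta,\eta}(t)=t^{\beta-1}(1-t)^{\eta-1}$ for $0<t<1$. For $y\ge 0$ let $S^\alpha_y$ be the transform $$S^\alpha_y\varphi(q)=\int_0^\infty R^\alpha_q(x,y)\,\varphi(x)\,x^\alpha e^{-x}\,dx,\qquad q\in\mathbb{H},\ |q|<1,$$ with the kernel $$R^\alpha_q(x,y)=\frac{1}{(1-q)\,(\sqrt{qxy})^{\alpha}}\exp\Big(-\frac{q(x+y)}{1-q}\Big)\,I_\alpha\Big(\frac{2\sqrt{qxy}}{1-q}\Big),\qquad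 I_\alpha(\xi)=\sum_{n=0}^\infty\frac{1}{n!\,\Gamma(\alpha+n+1)}\Big(\frac{\xi}{2}\Big)^{2n+\alpha},$$ where powers are principal and the kernel is extended by continuity to $qxy=0$; that is, $$R^\alpha_q(x,y)=(1-q)^{-\alpha-1}\exp\Big(-\frac{q(x+y)}{1-q}\Big)\sum_{n=0}^\infty\frac{1}{n!\,\Gamma(\alpha+n+1)}\Big(\frac{qxy}{(1-q)^2}\Big)^{n}.$$ Say that $S^\alpha_y$ is bounded if the integral converges absolutely for all $\varphi\in L^{2,\alpha}_{\mathbb{H}}(\mathbb{R}^+)$ and all $|q|<1$, and $\varphi\mapsto S^\alpha_y\varphi|_{\mathbb{B}_I}$ is a bounded right $\mathbb{H}$-linear operator from $L^{2,\alpha}_{\mathbb{H}}(\mathbb{R}^+)$ to $L^{2,\omega_{\beta,\eta}}_{\mathbb{H}}(\mathbb{B}_I)$. Then $S^\alpha_y$ is bounded for every $y>0$ (with no further condition on $\eta$), and $S^\alpha_0$ is bounded if $\eta\ge\alpha$. -/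

import Mathlib

open MeasureTheory Set
open scoped Quaternion ENNReal

noncomputable section

namespace DualHankel

instance : MeasurableSpace ℍ[ℝ] := borel _
instance : BorelSpace ℍ[ℝ] := ⟨rfl⟩

/-- The embedding `x + i y ↦ x + I y` of the complex plane onto the slice `ℂ_I = ℝ + I ℝ`
of the quaternions, for a quaternion `I` (with `I * I = -1` in all uses). -/
def slice (I : ℍ[ℝ]) (z : ℂ) : ℍ[ℝ] := (z.re : ℍ[ℝ]) + (z.im : ℍ[ℝ]) * I

theorem measurable_slice (I : ℍ[ℝ]) : Measurable (slice I) := by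
  have : Continuous (slice I) :=
    (Quaternion.continuous_coe.comp Complex.continuous_re).add
      ((Quaternion.continuous_coe.comp Complex.continuous_im).mul continuous_const)
  exact this.measurable

/-- The extension to quaternions of a complex function `f` with `f (conj z) = conj (f z)`:
if `q = x + I y` with `I * I = -1` and `f (x + i y) = u + i v`, then its value at `q` is `u + I v`.
Here `q` is written with `y = ‖q.im‖` and `I = q.im / ‖q.im‖`; for real `q` one has `v = 0`. -/
def sliceExt (f : ℂ → ℂ) (q : ℍ[ℝ]) : ℍ[ℝ] :=
  ((f ⟨q.re, ‖q.im‖⟩).re : ℍ[ℝ]) + (f ⟨q.re, ‖q.im‖⟩).im • (‖q.im‖⁻¹ • q.im)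

/-- The value of the extension of `f` at `x + I y` does not depend on how the point is written. -/
theorem sliceExt_slice (f : ℂ → ℂ) (z : ℂ) (I : ℍ[ℝ]) (hI : I * I = -1)
    (hf : f (starRingEnd ℂ z) = starRingEnd ℂ (f z)) :
    sliceExt f (slice I z) = slice I (f z) := by
  have h0 := congrArg QuaternionAlgebra.re hI
  have h1 := congrArg QuaternionAlgebra.imI hI
  have h2 := congrArg QuaternionAlgebra.imJ hI
  have h3 := congrArg QuaternionAlgebra.imK hI
  simp only [Quaternion.re_mul, Quaternion.imI_mul, Quaternion.imJ_mul, Quaternion.imK_mul,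
    Quaternion.re_neg, Quaternion.imI_neg, Quaternion.imJ_neg, Quaternion.imK_neg,
    Quaternion.re_one, Quaternion.imI_one, Quaternion.imJ_one, Quaternion.imK_one] at h0 h1 h2 h3
  have hre : I.re = 0 := by
    by_contra h
    have e1 : I.imI = 0 := by
      have : I.re * I.imI = 0 := by linarith
      simpa [h] using this
    have e2 : I.imJ = 0 := by
      have : I.re * I.imJ = 0 := by linarith
      simpa [h] using this
    have e3 : I.imK = 0 := by
      have : I.re * I.imK = 0 := by linarith
      simpa [h] using this
    rw [e1, e2, e3] at h0
    nlinarith [mul_self_nonneg I.re]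
  have hIm : I.im = I := by
    ext <;> simp [hre]
  have hn : ‖I‖ = 1 := by
    have hh : ‖I‖ * ‖I‖ = 1 := by
      rw [← norm_mul, hI, norm_neg, norm_one]
    nlinarith [norm_nonneg I]
  have hq : (slice I z).re = z.re := by
    simp [slice, hre]
  have hqi : (slice I z).im = z.im • I := by
    ext <;> simp [slice, hre]
  have hnq : ‖(slice I z).im‖ = |z.im| := by
    rw [hqi, norm_smul, hn, mul_one, Real.norm_eq_abs]
  unfold sliceExt
  rw [hnq, hq, hqi]
  rcases lt_trichotomy z.im 0 with h | h | h
  · have hz : (⟨z.re, |z.im|⟩ : ℂ) = starRingEnd ℂ z := by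
      apply Complex.ext <;> simp [abs_of_neg h]
    rw [hz, hf, abs_of_neg h, smul_smul, smul_smul]
    have hv : (starRingEnd ℂ (f z)).im * (-z.im)⁻¹ * z.im = (f z).im := by
      have : z.im ≠ 0 := h.ne
      rw [Complex.conj_im]
      field_simp
    rw [hv]
    ext <;> simp [slice, hre]
  · have hz : (⟨z.re, |z.im|⟩ : ℂ) = z := by
      apply Complex.ext <;> simp [h]
    have hc : starRingEnd ℂ z = z := by
      apply Complex.ext <;> simp [h]
    have hv : (f z).im = 0 := by
      rw [hc] at hf
      have := congrArg Complex.im hf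
      simp at this
      linarith
    rw [hz]
    simp [slice, hv]
  · have hz : (⟨z.re, |z.im|⟩ : ℂ) = z := by
      apply Complex.ext <;> simp [abs_of_pos h]
    rw [hz, abs_of_pos h, smul_smul, smul_smul, mul_assoc, inv_mul_cancel₀ h.ne', mul_one]
    ext <;> simp [slice, hre]

/-- The modified Bessel function `I_α`, with principal powers. -/
def besselI (α : ℝ) (ξ : ℂ) : ℂ :=
  ∑' n : ℕ, (1 / ((n.factorial : ℂ) * (Real.Gamma (α + n + 1) : ℂ))) *
    (ξ / 2) ^ ((2 * n + α : ℝ) : ℂ)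

/-- The entire function `w ↦ ∑ wⁿ / (n! Γ(α+n+1))`, which at `w = (ξ/2)²` equals
`(ξ/2)^(-α) I_α(ξ)`. -/
def besselEntire (α : ℝ) (w : ℂ) : ℂ :=
  ∑' n : ℕ, (1 / ((n.factorial : ℂ) * (Real.Gamma (α + n + 1) : ℂ))) * w ^ n

/-- The kernel `R_z^α(x,y)` for `z` in the unit disc and `x, y ≥ 0`. It is written with the entire
part of the Bessel function, so that the removable singularities at `z x y = 0` are filled in by
continuity; for `z x y ≠ 0` see `kernelC_eq_besselI`. -/
def kernelC (α : ℝ) (x y : ℝ) (z : ℂ) : ℂ :=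
  (1 / (1 - z) ^ ((α + 1 : ℝ) : ℂ)) * Complex.exp (-(z * (x + y)) / (1 - z)) *
    besselEntire α (z * x * y / (1 - z) ^ 2)

/-- The kernel in terms of the modified Bessel function. -/
theorem kernelC_eq_besselI (α x y : ℝ) (z : ℂ) (hx : 0 < x) (hy : 0 < y) (hz : z ≠ 0)
    (hz1 : ‖z‖ < 1) :
    kernelC α x y z =
      (1 / ((1 - z) * ((z * x * y) ^ (1 / 2 : ℂ)) ^ (α : ℂ))) *
        Complex.exp (-(z * (x + y)) / (1 - z)) *
        besselI α (2 * (z * x * y) ^ (1 / 2 : ℂ) / (1 - z)) := by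
  have hre : 0 < (1 - z).re := by
    have := (Complex.re_le_norm z).trans_lt hz1
    simpa using this
  have h1 : (1 - z) ≠ 0 := by
    intro h
    rw [h] at hre
    simp at hre
  have hw : z * x * y ≠ 0 := by
    have hx' : (x : ℂ) ≠ 0 := by exact_mod_cast hx.ne'
    have hy' : (y : ℂ) ≠ 0 := by exact_mod_cast hy.ne'
    exact mul_ne_zero (mul_ne_zero hz hx') hy'
  set w : ℂ := z * x * y with hwdef
  set s : ℂ := w ^ (1 / 2 : ℂ) with hs
  have hs2 : s ^ 2 = w := by
    rw [hs, ← Complex.cpow_nat_mul]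
    simp
  have hs0 : s ≠ 0 := by
    intro h
    rw [h] at hs2
    exact hw (by simpa using hs2.symm)
  have hlog : (Complex.log w * (1 / 2 : ℂ)).im = w.arg / 2 := by
    rw [show Complex.log w * (1 / 2 : ℂ) = ((1 / 2 : ℝ) : ℂ) * Complex.log w by
      push_cast; ring, Complex.im_ofReal_mul, Complex.log_im]
    ring
  have hargs : s.arg = w.arg / 2 := by
    rw [← Complex.log_im s, hs, Complex.cpow_def_of_ne_zero hw, Complex.log_exp, hlog]
    · rw [hlog]
      linarith [Complex.neg_pi_lt_arg w, Real.pi_pos]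
    · rw [hlog]
      linarith [Complex.arg_le_pi w, Real.pi_pos]
  have harg1 : |(1 - z).arg| < Real.pi / 2 :=
    Complex.abs_arg_lt_pi_div_two_iff.2 (Or.inl hre)
  obtain ⟨ha, hb⟩ := abs_lt.1 harg1
  have hpi : (1 - z).arg ≠ Real.pi := by
    intro h
    linarith [Real.pi_pos]
  have hinv : ((1 - z)⁻¹).arg = -(1 - z).arg := by
    rw [Complex.arg_inv, if_neg hpi]
  have hpow : (s / (1 - z)) ^ (α : ℂ) = s ^ (α : ℂ) / (1 - z) ^ (α : ℂ) := by
    rw [div_eq_mul_inv, div_eq_mul_inv, ← Complex.inv_cpow _ _ hpi,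
      Complex.cpow_def_of_ne_zero (mul_ne_zero hs0 (inv_ne_zero h1)),
      Complex.cpow_def_of_ne_zero hs0, Complex.cpow_def_of_ne_zero (inv_ne_zero h1),
      ← Complex.exp_add, ← add_mul, Complex.log_mul hs0 (inv_ne_zero h1)]
    rw [hargs, hinv]
    constructor
    · linarith [Complex.neg_pi_lt_arg w]
    · linarith [Complex.arg_le_pi w]
  have hsd : s / (1 - z) ≠ 0 := div_ne_zero hs0 h1
  have hB : besselI α (2 * s / (1 - z)) =
      (s ^ (α : ℂ) / (1 - z) ^ (α : ℂ)) * besselEntire α (w / (1 - z) ^ 2) := by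
    rw [besselI, besselEntire, ← tsum_mul_left]
    congr 1
    funext n
    rw [show 2 * s / (1 - z) / 2 = s / (1 - z) by ring,
      show ((2 * n + α : ℝ) : ℂ) = ((2 * n : ℕ) : ℂ) + (α : ℂ) by push_cast; ring,
      Complex.cpow_add _ _ hsd, hpow, Complex.cpow_natCast, pow_mul, div_pow, hs2]
    ring
  have hsa : s ^ (α : ℂ) ≠ 0 := by simp [Complex.cpow_eq_zero_iff, hs0]
  have hza : (1 - z) ^ (α : ℂ) ≠ 0 := by simp [Complex.cpow_eq_zero_iff, h1]
  rw [hB, kernelC, ← hwdef, show ((α + 1 : ℝ) : ℂ) = (α : ℂ) + 1 by push_cast; ring,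
    Complex.cpow_add _ _ h1, Complex.cpow_one]
  field_simp

theorem kernelC_conj (α x y : ℝ) (z : ℂ) (hz1 : ‖z‖ < 1) :
    kernelC α x y (starRingEnd ℂ z) = starRingEnd ℂ (kernelC α x y z) := by
  have hre : 0 < (1 - z).re := by
    have := (Complex.re_le_norm z).trans_lt hz1
    simpa using this
  have hpi : (1 - z).arg ≠ Real.pi := by
    intro h
    have := (abs_lt.1 (Complex.abs_arg_lt_pi_div_two_iff.2 (Or.inl hre))).2
    linarith [Real.pi_pos]
  have hB : ∀ w : ℂ, besselEntire α (starRingEnd ℂ w) = starRingEnd ℂ (besselEntire α w) := by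
    intro w
    simp [besselEntire, Complex.conj_tsum]
  have hp : (1 - starRingEnd ℂ z) ^ ((α + 1 : ℝ) : ℂ) =
      starRingEnd ℂ ((1 - z) ^ ((α + 1 : ℝ) : ℂ)) := by
    have := Complex.cpow_conj (1 - z) ((α + 1 : ℝ) : ℂ) hpi
    rw [Complex.conj_ofReal] at this
    rw [this, Complex.conj_conj]
    simp
  simp only [kernelC, hp, map_mul, map_div₀, map_one, ← Complex.exp_conj, ← hB, map_neg, map_add,
    map_sub, map_pow, Complex.conj_ofReal]

/-- The kernel `R_q^α(x,y)` for a quaternion `q` in the unit ball. -/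
def kernel (α : ℝ) (x y : ℝ) (q : ℍ[ℝ]) : ℍ[ℝ] := sliceExt (kernelC α x y) q

/-- The measure `x^α e^{-x} dx` on `(0, ∞)`. -/
def laguerreMeasure (α : ℝ) : Measure ℝ :=
  (volume.restrict (Ioi 0)).withDensity fun x => ENNReal.ofReal (x ^ α * Real.exp (-x))

/-- The weight `ω_{β,η}(t) = t^{β-1} (1-t)^{η-1}` on `(0,1)`. -/
def weight (β η t : ℝ) : ℝ := t ^ (β - 1) * (1 - t) ^ (η - 1)

/-- The measure `ω_{β,η}(x² + y²) dx dy` on the disc `𝔹_I = {x + I y : x² + y² < 1}`, as a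
measure on the quaternions carried by `𝔹_I`. -/
def sliceMeasure (I : ℍ[ℝ]) (β η : ℝ) : Measure ℍ[ℝ] :=
  ((volume.restrict (Metric.ball (0 : ℂ) 1)).withDensity
    fun z => ENNReal.ofReal (weight β η (‖z‖ ^ 2))).map (slice I)

/-- The dual transform `S_y^α φ (q) = ∫_0^∞ R_q^α(x,y) φ(x) x^α e^{-x} dx`. -/
def dualTransform (α y : ℝ) (φ : ℝ → ℍ[ℝ]) (q : ℍ[ℝ]) : ℍ[ℝ] :=
  ∫ x, kernel α x y q * φ x ∂(laguerreMeasure α)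

/-- `S_y^α` is a well-defined bounded (right `ℍ`-linear) operator from `L²(ℝ⁺, x^α e^{-x} dx; ℍ)`
to `L²(𝔹_I, ω_{β,η}(|q|²) dx dy; ℍ)`: the defining integral converges absolutely at each point of
the unit ball, and the transform is given by a continuous linear map between the `L²` spaces. -/
def IsBoundedDualTransform (α β η : ℝ) (I : ℍ[ℝ]) (y : ℝ) : Prop :=
  (∀ φ : Lp ℍ[ℝ] 2 (laguerreMeasure α), ∀ q : ℍ[ℝ], ‖q‖ < 1 →
    Integrable (fun x => kernel α x y q * φ x) (laguerreMeasure α)) ∧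
  ∃ T : Lp ℍ[ℝ] 2 (laguerreMeasure α) →L[(ℍ[ℝ])ᵐᵒᵖ] Lp ℍ[ℝ] 2 (sliceMeasure I β η),
    ∀ φ : Lp ℍ[ℝ] 2 (laguerreMeasure α),
      T φ =ᵐ[sliceMeasure I β η] dualTransform α y φ

end DualHankel

end

noncomputable section

namespace DualHankel

/-! Let `e_n` be the orthonormal Laguerre polynomials for `x^α e^{-x} dx`. The Hille–Hardy formula
(`hasSum_kernelC`, `hasSum_kernel`) diagonalizes the kernel: `R_q(x,y) = ∑ e_n(x) e_n(y) q^n`.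
Integrating term by term, `S_y φ(q) = ∑ q^n e_n(y) c_n`, where `c_n` is the `n`-th Laguerre
coefficient of `φ`. Monomials are orthogonal on the weighted disc, with squared norms `M_n = π
B(n+β, η)`, of order `n^{-η}`. Hence `‖S_y φ‖² = ∑ e_n(y)² M_n ‖c_n‖²`, and by Bessel's inequality
boundedness follows once `e_n(y)² M_n` is bounded in `n` (`isBoundedDualTransform_of_le`).

For `y > 0` it suffices that `e_n(y)²` grows more slowly than every positive power of `n`. The
three-term recurrence of `e_n(y)` is a discrete form of `(a u')' = -y u` with `a_n = √(n(n+α))`,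
whose energy `a u'² + y u²` decreases as `a` grows. The discrete energy satisfies `E_{n+1} ≤ (1 +
ε/(n+1)) E_n` eventually, for each `ε > 0` (`eventually_laguerreEnergy_succ_le`), and the decay of
`M_n` absorbs this growth whatever `η > 0` is.

For `y = 0` the value is explicit: `e_n(0)²` is of order `n^α`, so `α ≤ η` suffices. -/

/-! ### Laguerre polynomials: coefficients, derivative relation, recurrence -/

/-- The Laguerre polynomial `L_n^α` divided by its value `Γ(α+n+1) / n!` of the weight
`laguerreWeight α n`, that is `∑ j, (-1)^j (n choose j) / Γ(α+j+1) X^j`. -/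
def scaledLaguerre (α : ℝ) (n : ℕ) : Polynomial ℝ :=
  ∑ j ∈ Finset.range (n + 1),
    Polynomial.monomial j ((-1) ^ j * (n.choose j : ℝ) / Real.Gamma (α + j + 1))

/-- The factor `Γ(α+n+1) / n!`. -/
def laguerreWeight (α : ℝ) (n : ℕ) : ℝ := Real.Gamma (α + n + 1) / n.factorial

theorem gamma_pos {α : ℝ} (hα : -1 < α) (n : ℕ) : 0 < Real.Gamma (α + n + 1) :=
  Real.Gamma_pos_of_pos (by have : (0 : ℝ) ≤ n := n.cast_nonneg; linarith)

theorem gamma_succ {α : ℝ} (hα : -1 < α) (n : ℕ) :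
    Real.Gamma (α + (n + 1 : ℕ) + 1) = (α + n + 1) * Real.Gamma (α + n + 1) := by
  rw [← Real.Gamma_add_one]
  · congr 1; push_cast; ring
  · have : (0 : ℝ) ≤ n := n.cast_nonneg
    linarith

theorem laguerreWeight_pos {α : ℝ} (hα : -1 < α) (n : ℕ) : 0 < laguerreWeight α n :=
  div_pos (gamma_pos hα n) (by exact_mod_cast n.factorial_pos)

theorem laguerreWeight_succ {α : ℝ} (hα : -1 < α) (n : ℕ) :
    (n + 1) * laguerreWeight α (n + 1) = (α + n + 1) * laguerreWeight α n := by
  have h1 : (n.factorial : ℝ) ≠ 0 := by exact_mod_cast n.factorial_ne_zero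
  have h2 : (n : ℝ) + 1 ≠ 0 := by positivity
  rw [laguerreWeight, laguerreWeight, gamma_succ hα, Nat.factorial_succ]
  push_cast
  field_simp

theorem coeff_scaledLaguerre (α : ℝ) (n j : ℕ) :
    (scaledLaguerre α n).coeff j = (-1) ^ j * (n.choose j : ℝ) / Real.Gamma (α + j + 1) := by
  simp only [scaledLaguerre, Polynomial.finsetSum_coeff, Polynomial.coeff_monomial,
    Finset.sum_ite_eq', Finset.mem_range]
  split_ifs with h
  · rfl
  · rw [Nat.choose_eq_zero_of_lt (by omega)]
    simp

theorem aeval_scaledLaguerre (α : ℝ) (n : ℕ) (w : ℂ) :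
    Polynomial.aeval w (scaledLaguerre α n) =
      ∑ j ∈ Finset.range (n + 1), (n.choose j : ℂ) * (-w) ^ j / (Real.Gamma (α + j + 1) : ℂ) := by
  simp only [scaledLaguerre, map_sum, Polynomial.aeval_monomial]
  refine Finset.sum_congr rfl fun j _ => ?_
  rw [neg_pow w]
  simp
  ring

theorem eval_scaledLaguerre (α : ℝ) (n : ℕ) (x : ℝ) :
    (scaledLaguerre α n).eval x =
      ∑ j ∈ Finset.range (n + 1), (n.choose j : ℝ) * (-x) ^ j / Real.Gamma (α + j + 1) := by
  simp only [scaledLaguerre, Polynomial.eval_finsetSum, Polynomial.eval_monomial]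
  refine Finset.sum_congr rfl fun j _ => ?_
  rw [neg_pow x]
  ring

theorem aeval_ofReal_scaledLaguerre (α : ℝ) (n : ℕ) (x : ℝ) :
    Polynomial.aeval (x : ℂ) (scaledLaguerre α n) = (((scaledLaguerre α n).eval x : ℝ) : ℂ) := by
  rw [aeval_scaledLaguerre, eval_scaledLaguerre]
  push_cast
  rfl

/-- The coefficients alternate in sign, so at `-|x|` every term is nonnegative. This supplies the
majorant for absolute convergence of the double series below. -/
theorem abs_eval_scaledLaguerre_le {α : ℝ} (hα : -1 < α) (n : ℕ) (x : ℝ) :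
    |(scaledLaguerre α n).eval x| ≤ (scaledLaguerre α n).eval (-|x|) := by
  rw [eval_scaledLaguerre, eval_scaledLaguerre, neg_neg]
  refine (Finset.abs_sum_le_sum_abs _ _).trans (Finset.sum_le_sum fun j _ => ?_)
  rw [abs_div, abs_mul, abs_pow, abs_neg, abs_of_pos (gamma_pos hα j), Nat.abs_cast]

/-- The derivative relation between consecutive Laguerre polynomials. -/
theorem scaledLaguerre_derivative {α : ℝ} (hα : -1 < α) (n : ℕ) :
    (Polynomial.C (α + n + 1) - Polynomial.X) * scaledLaguerre α n +
      Polynomial.X * Polynomial.derivative (scaledLaguerre α n) =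
      Polynomial.C (α + n + 1) * scaledLaguerre α (n + 1) := by
  ext j
  rw [sub_mul]
  cases j with
  | zero => simp [coeff_scaledLaguerre]
  | succ j =>
    have hg := (gamma_pos hα j).ne'
    have hj : α + j + 1 ≠ 0 := by have : (0 : ℝ) ≤ j := j.cast_nonneg; linarith
    simp only [Polynomial.coeff_add, Polynomial.coeff_sub, Polynomial.coeff_C_mul,
      Polynomial.coeff_X_mul, Polynomial.coeff_derivative, coeff_scaledLaguerre, gamma_succ hα]
    have h1 : ((n.choose (j + 1) : ℕ) : ℝ) * (j + 1) = n.choose j * (n - j) := by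
      rcases le_or_gt j n with h | h
      · have := Nat.choose_succ_right_eq n j
        rw [← Nat.cast_sub h]
        exact_mod_cast this
      · simp [Nat.choose_eq_zero_of_lt h, Nat.choose_eq_zero_of_lt (h.trans (Nat.lt_succ_self j))]
    rw [Nat.choose_succ_succ' n j]
    push_cast
    field_simp
    rw [pow_succ]
    linear_combination (-(-1 : ℝ) ^ j) * h1

/-- The three-term recurrence. -/
theorem scaledLaguerre_recurrence {α : ℝ} (hα : -1 < α) (n : ℕ) :
    Polynomial.C (α + n + 2) * scaledLaguerre α (n + 2) =
      (Polynomial.C (2 * n + 3 + α) - Polynomial.X) * scaledLaguerre α (n + 1) -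
        Polynomial.C (n + 1 : ℝ) * scaledLaguerre α n := by
  ext j
  rw [sub_mul]
  cases j with
  | zero =>
    simp [coeff_scaledLaguerre]
    ring
  | succ j =>
    have hg := (gamma_pos hα j).ne'
    have hj : α + j + 1 ≠ 0 := by have : (0 : ℝ) ≤ j := j.cast_nonneg; linarith
    simp only [Polynomial.coeff_sub, Polynomial.coeff_C_mul,
      Polynomial.coeff_X_mul, coeff_scaledLaguerre, gamma_succ hα]
    have h1 : ((n + 1).choose (j + 1) : ℝ) * (j + 1) = (n + 1) * n.choose j := by
      exact_mod_cast (Nat.add_one_mul_choose_eq n j).symm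
    have h2 : ((n + 1).choose (j + 1) : ℝ) = n.choose j + n.choose (j + 1) := by
      exact_mod_cast Nat.choose_succ_succ' n j
    have h3 : ((n + 2).choose (j + 1) : ℝ) = (n + 1).choose j + (n + 1).choose (j + 1) := by
      exact_mod_cast Nat.choose_succ_succ' (n + 1) j
    have h4 : ((n + 1).choose (j + 1) : ℝ) * (j + 1) = (n + 1).choose j * (n + 1 - j) := by
      rcases le_or_gt j (n + 1) with h | h
      · have := Nat.choose_succ_right_eq (n + 1) j
        have h' : ((n + 1 - j : ℕ) : ℝ) = n + 1 - j := by rw [Nat.cast_sub h]; push_cast; ring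
        rw [← h']
        exact_mod_cast this
      · simp [Nat.choose_eq_zero_of_lt h, Nat.choose_eq_zero_of_lt (h.trans (Nat.lt_succ_self j))]
    rw [h3]
    field_simp
    rw [pow_succ]
    have h5 : (n.choose (j + 1) : ℝ) = (n + 1).choose (j + 1) - n.choose j := by linarith
    rw [h5]
    linear_combination (-(-1 : ℝ) ^ j) * (h1 - h4)

/-! ### The generating function of the Laguerre polynomials and its derivatives -/

/-- Taylor expansion at the origin of a sequence of functions each of which is, up to a factor,
the derivative of the previous one. -/
theorem hasSum_of_hasDerivAt_succ {F : ℕ → ℂ → ℂ}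
    (hF : ∀ k, ∀ z ∈ Metric.ball (0 : ℂ) 1, HasDerivAt (F k) ((k + 1) * F (k + 1) z) z)
    (k : ℕ) {z : ℂ} (hz : z ∈ Metric.ball (0 : ℂ) 1) :
    HasSum (fun n : ℕ => ((n + k).choose k : ℂ) * F (n + k) 0 * z ^ n) (F k z) := by
  have hd : ∀ n, ∀ z ∈ Metric.ball (0 : ℂ) 1,
      iteratedDeriv n (F k) z = (n.factorial * (n + k).choose k : ℂ) * F (n + k) z := by
    intro n
    induction n with
    | zero => intro z _; simp
    | succ n ih =>
      intro z hz
      have he : iteratedDeriv n (F k) =ᶠ[nhds z]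
          fun z => (n.factorial * (n + k).choose k : ℂ) * F (n + k) z :=
        Filter.mem_of_superset (Metric.isOpen_ball.mem_nhds hz) ih
      rw [iteratedDeriv_succ, he.deriv_eq, ((hF (n + k) z hz).const_mul _).deriv,
        show n + 1 + k = n + k + 1 by ring]
      have h : ((n + k + 1).choose k * (n + 1) : ℂ) = (n + k).choose k * (n + k + 1) := by
        have := Nat.choose_mul_succ_eq (n + k) k
        rw [show n + k + 1 - k = n + 1 by omega] at this
        exact_mod_cast this.symm
      rw [Nat.factorial_succ]
      push_cast
      linear_combination (-(n.factorial : ℂ) * F (n + k + 1) z) * h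
  have hdiff : DifferentiableOn ℂ (F k) (Metric.ball 0 1) := fun z hz =>
    (hF k z hz).differentiableAt.differentiableWithinAt
  have h := Complex.hasSum_taylorSeries_on_ball hdiff hz
  have he : (fun n : ℕ => ((n + k).choose k : ℂ) * F (n + k) 0 * z ^ n) =
      fun n : ℕ => (n.factorial : ℂ)⁻¹ • (z - 0) ^ n • iteratedDeriv n (F k) 0 := by
    funext n
    rw [hd n 0 (Metric.mem_ball_self one_pos)]
    have : (n.factorial : ℂ) ≠ 0 := by exact_mod_cast n.factorial_ne_zero
    simp only [sub_zero, smul_eq_mul]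
    field_simp
  rw [he]
  exact h

/-- The normalized `k`-th derivative in `z` of the generating function of the Laguerre
polynomials. -/
def laguerreGen (α : ℝ) (x : ℂ) (k : ℕ) (z : ℂ) : ℂ :=
  (1 - z) ^ (-(α + k + 1 : ℂ)) * Complex.exp (-(x * z) / (1 - z)) * (laguerreWeight α k : ℂ) *
    Polynomial.aeval (x / (1 - z)) (scaledLaguerre α k)

theorem one_sub_mem_slitPlane {z : ℂ} (hz : ‖z‖ < 1) : 1 - z ∈ Complex.slitPlane := by
  have := (Complex.re_le_norm z).trans_lt hz
  left
  simpa using this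

/-- The product rule leaves a combination of the `k`-th polynomial and its derivative at `x / (1 -
z)`, exactly the one that `scaledLaguerre_derivative` collapses to the next polynomial. The factor
`k + 1` comes from dividing the `k`-th derivative by `k!`. -/
theorem hasDerivAt_laguerreGen {α : ℝ} (hα : -1 < α) (x : ℂ) (k : ℕ) {z : ℂ} (hz : ‖z‖ < 1) :
    HasDerivAt (laguerreGen α x k) ((k + 1) * laguerreGen α x (k + 1) z) z := by
  have hs := one_sub_mem_slitPlane hz
  have h0 : 1 - z ≠ 0 := Complex.slitPlane_ne_zero hs
  have h1 : HasDerivAt (fun z : ℂ => 1 - z) (-1) z := by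
    simpa using (hasDerivAt_id z).const_sub 1
  have hc := h1.cpow_const (c := -(α + k + 1 : ℂ)) hs
  have he : HasDerivAt (fun z : ℂ => Complex.exp (-(x * z) / (1 - z))) _ z :=
    ((((hasDerivAt_id z).const_mul x).neg).div h1 h0).cexp
  have hq : HasDerivAt (fun z : ℂ => x / (1 - z)) _ z := (hasDerivAt_const z x).div h1 h0
  have hp := ((scaledLaguerre α k).hasDerivAt_aeval (x / (1 - z))).comp z hq
  have h := ((hc.mul he).mul_const (laguerreWeight α k : ℂ)).mul hp
  refine h.congr_deriv ?_
  have hrel := congrArg (Polynomial.aeval (x / (1 - z))) (scaledLaguerre_derivative hα k)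
  simp only [map_add, map_mul, map_sub, Polynomial.aeval_C, Polynomial.aeval_X,
    Complex.coe_algebraMap] at hrel
  push_cast at hrel
  have hw : ((k : ℂ) + 1) * (laguerreWeight α (k + 1) : ℂ) =
      (α + k + 1) * (laguerreWeight α k : ℂ) := by exact_mod_cast laguerreWeight_succ hα k
  have hpow : (1 - z) ^ (-(α + k + 1 : ℂ)) =
      (1 - z) * (1 - z) ^ (-(α + (k + 1 : ℕ) + 1 : ℂ)) := by
    rw [show (-(α + k + 1 : ℂ)) = 1 + -(α + (k + 1 : ℕ) + 1 : ℂ) by push_cast; ring,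
      Complex.cpow_add _ _ h0, Complex.cpow_one]
  have hpow' : (1 - z) ^ (-(α + k + 1 : ℂ) - 1) = (1 - z) ^ (-(α + (k + 1 : ℕ) + 1 : ℂ)) := by
    congr 1; push_cast; ring
  simp only [Function.comp_apply, Pi.neg_apply, Pi.mul_apply, Pi.div_apply, id]
  rw [hpow', hpow, laguerreGen]
  set A := (1 - z) ^ (-(α + (k + 1 : ℕ) + 1 : ℂ))
  set E := Complex.exp (-(x * z) / (1 - z))
  set g := (laguerreWeight α k : ℂ)
  set P := Polynomial.aeval (x / (1 - z)) (scaledLaguerre α k)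
  set P' := Polynomial.aeval (x / (1 - z)) (Polynomial.derivative (scaledLaguerre α k))
  set Q := Polynomial.aeval (x / (1 - z)) (scaledLaguerre α (k + 1))
  rw [show ((k : ℂ) + 1) * (A * E * (laguerreWeight α (k + 1) : ℂ) * Q) =
    A * E * g * ((α + k + 1) * Q) by linear_combination (A * E * Q) * hw, ← hrel]
  field_simp
  ring

theorem laguerreGen_zero (α : ℝ) (x : ℂ) (k : ℕ) :
    laguerreGen α x k 0 =
      (laguerreWeight α k : ℂ) * Polynomial.aeval x (scaledLaguerre α k) := by
  simp [laguerreGen]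

/-- The generating function of the Laguerre polynomials and its derivatives. -/
theorem hasSum_laguerreGen {α : ℝ} (hα : -1 < α) (x : ℂ) (k : ℕ) {z : ℂ} (hz : ‖z‖ < 1) :
    HasSum (fun n : ℕ => ((n + k).choose k : ℂ) * ((laguerreWeight α (n + k) : ℂ) *
      Polynomial.aeval x (scaledLaguerre α (n + k))) * z ^ n) (laguerreGen α x k z) := by
  have h := hasSum_of_hasDerivAt_succ (F := laguerreGen α x)
    (fun k z hz => hasDerivAt_laguerreGen hα x k (by simpa using hz)) k
    (z := z) (by simpa using hz)
  simpa only [laguerreGen_zero] using h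

/-! ### The Hille–Hardy formula -/

/-- The factor `α + n + 1` in the recursion for Gamma is at least `1` from `n = 1` on, but may be
smaller at `n = 0`. So the reciprocals decrease only from the second one, and the sum of the first
two bounds them all. -/
theorem inv_gamma_le {α : ℝ} (hα : -1 < α) (n : ℕ) :
    (Real.Gamma (α + n + 1))⁻¹ ≤ (Real.Gamma (α + 1))⁻¹ + (Real.Gamma (α + 2))⁻¹ := by
  have h0 : 0 < (Real.Gamma (α + 1))⁻¹ := by simpa using inv_pos.2 (gamma_pos hα 0)
  have h1 : 0 < (Real.Gamma (α + 2))⁻¹ :=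
    inv_pos.2 (Real.Gamma_pos_of_pos (by linarith))
  rcases n with _ | n
  · simpa using h1.le
  · induction n with
    | zero =>
      rw [show α + ((0 + 1 : ℕ) : ℝ) + 1 = α + 2 by push_cast; ring]
      linarith
    | succ n ih =>
      refine le_trans ?_ ih
      rw [gamma_succ hα (n + 1), mul_inv]
      have hn : (0 : ℝ) ≤ n := n.cast_nonneg
      refine mul_le_of_le_one_left (inv_nonneg.2 (gamma_pos hα _).le) (inv_le_one_of_one_le₀ ?_)
      push_cast
      linarith

theorem summable_norm_besselEntire {α : ℝ} (hα : -1 < α) (w : ℂ) :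
    Summable fun n : ℕ =>
      ‖(1 / ((n.factorial : ℂ) * (Real.Gamma (α + n + 1) : ℂ))) * w ^ n‖ := by
  refine Summable.of_nonneg_of_le (fun _ => norm_nonneg _) (fun n => ?_)
    ((Real.summable_pow_div_factorial ‖w‖).mul_left
      ((Real.Gamma (α + 1))⁻¹ + (Real.Gamma (α + 2))⁻¹))
  have hg := gamma_pos hα n
  rw [norm_mul, norm_div, norm_mul, norm_one, norm_pow, Complex.norm_natCast, Complex.norm_real,
    Real.norm_of_nonneg hg.le]
  calc 1 / ((n.factorial : ℝ) * Real.Gamma (α + n + 1)) * ‖w‖ ^ n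
      = (Real.Gamma (α + n + 1))⁻¹ * (‖w‖ ^ n / n.factorial) := by
        field_simp
    _ ≤ _ := mul_le_mul_of_nonneg_right (inv_gamma_le hα n) (by positivity)

theorem sum_antidiagonal_eq_aeval_scaledLaguerre (α : ℝ) (t w : ℂ) (n : ℕ) :
    ∑ p ∈ Finset.HasAntidiagonal.antidiagonal n,
      (1 / ((p.1.factorial : ℂ) * (Real.Gamma (α + p.1 + 1) : ℂ))) * (-w * t) ^ p.1 *
        (t ^ p.2 / p.2.factorial) =
      t ^ n * Polynomial.aeval w (scaledLaguerre α n) / n.factorial := by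
  rw [Finset.Nat.sum_antidiagonal_eq_sum_range_succ
    (fun i j : ℕ => (1 / ((i.factorial : ℂ) * (Real.Gamma (α + i + 1) : ℂ))) * (-w * t) ^ i *
        (t ^ j / j.factorial)), aeval_scaledLaguerre, Finset.mul_sum, Finset.sum_div]
  refine Finset.sum_congr rfl fun j hj => ?_
  have hj' : j ≤ n := Nat.lt_succ_iff.1 (Finset.mem_range.1 hj)
  have h1 : (n.choose j : ℂ) * j.factorial * (n - j).factorial = n.factorial := by
    exact_mod_cast Nat.choose_mul_factorial_mul_factorial hj'
  have h2 : t ^ n = t ^ j * t ^ (n - j) := by rw [← pow_add]; congr 1; omega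
  have h3 : (j.factorial : ℂ) ≠ 0 := by exact_mod_cast j.factorial_ne_zero
  have h4 : ((n - j).factorial : ℂ) ≠ 0 := by exact_mod_cast (n - j).factorial_ne_zero
  have h5 : (n.choose j : ℂ) ≠ 0 := by exact_mod_cast (Nat.choose_pos hj').ne'
  rw [← h1, h2, mul_pow]
  simp only [div_eq_mul_inv, mul_inv]
  field_simp

/-- The exponential generating function of the scaled Laguerre polynomials. -/
theorem hasSum_exp_mul_besselEntire {α : ℝ} (hα : -1 < α) (t w : ℂ) :
    HasSum (fun k : ℕ => t ^ k * Polynomial.aeval w (scaledLaguerre α k) / k.factorial)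
      (Complex.exp t * besselEntire α (-w * t)) := by
  have hf := summable_norm_besselEntire hα (-w * t)
  have hg : Summable fun n : ℕ => ‖t ^ n / (n.factorial : ℂ)‖ := by
    simpa [norm_div, norm_pow] using Real.summable_pow_div_factorial ‖t‖
  have hs := (summable_norm_sum_mul_antidiagonal_of_summable_norm hf hg).of_norm
  have h := tsum_mul_tsum_eq_tsum_sum_antidiagonal_of_summable_norm hf hg
  simp only [sum_antidiagonal_eq_aeval_scaledLaguerre] at hs h
  have he : ∑' n : ℕ, t ^ n / (n.factorial : ℂ) = Complex.exp t := by
    rw [Complex.exp_eq_exp_ℂ, NormedSpace.exp_eq_tsum_div]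
  rw [he] at h
  rw [mul_comm, besselEntire, h]
  exact hs.hasSum

/-- Split off `exp(-xz/(1-z))` and expand the remaining exponential times Bessel factor by
`hasSum_exp_mul_besselEntire` with `t = -yz/(1-z)` and `w = x/(1-z)`, for which `-wt = xyz/(1-z)²`.
The powers of `1 - z` then recombine into `laguerreGen`. -/
theorem hasSum_laguerreGen_eq_kernelC {α : ℝ} (hα : -1 < α) (x y : ℝ) {z : ℂ} (hz : ‖z‖ < 1) :
    HasSum (fun k : ℕ => (-(y : ℂ) * z) ^ k / (Real.Gamma (α + k + 1) : ℂ) * laguerreGen α x k z)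
      (kernelC α x y z) := by
  have h0 : 1 - z ≠ 0 := Complex.slitPlane_ne_zero (one_sub_mem_slitPlane hz)
  have h := (hasSum_exp_mul_besselEntire hα (-(y * z) / (1 - z)) (x / (1 - z))).mul_left
    ((1 - z) ^ (-(α + 1 : ℂ)) * Complex.exp (-(x * z) / (1 - z)))
  have hK : kernelC α x y z = (1 - z) ^ (-(α + 1 : ℂ)) * Complex.exp (-(x * z) / (1 - z)) *
      (Complex.exp (-(y * z) / (1 - z)) * besselEntire α (-(x / (1 - z)) * (-(y * z) / (1 - z)))) := by
    rw [kernelC, Complex.cpow_neg,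
      show -(z * ((x : ℂ) + y)) / (1 - z) = -(x * z) / (1 - z) + -(y * z) / (1 - z) by ring,
      Complex.exp_add, show z * (x : ℂ) * y / (1 - z) ^ 2 =
        -(x / (1 - z)) * (-(y * z) / (1 - z)) by field_simp]
    push_cast
    ring
  rw [hK]
  refine Eq.mp (congrArg (HasSum · _) (funext fun k => Eq.symm ?_)) h
  have hg : (Real.Gamma (α + k + 1) : ℂ) ≠ 0 := by exact_mod_cast (gamma_pos hα k).ne'
  have hk : (k.factorial : ℂ) ≠ 0 := by exact_mod_cast k.factorial_ne_zero
  have hw : (laguerreWeight α k : ℂ) = (Real.Gamma (α + k + 1) : ℂ) / k.factorial := by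
    simp [laguerreWeight]
  rw [laguerreGen, hw, show (-(α + k + 1 : ℂ)) = -(α + 1 : ℂ) - (k : ℂ) by ring,
    Complex.cpow_sub _ _ h0, Complex.cpow_natCast,
    show -((y : ℂ) * z) / (1 - z) = -(y : ℂ) * z / (1 - z) by ring, div_pow]
  field_simp

/-- The double series behind the Hille–Hardy formula. -/
def hilleHardyTerm (α x y : ℝ) (z : ℂ) (p : ℕ × ℕ) : ℂ :=
  (-(y : ℂ) * z) ^ p.1 / (Real.Gamma (α + p.1 + 1) : ℂ) *
    (((p.2 + p.1).choose p.1 : ℂ) * ((laguerreWeight α (p.2 + p.1) : ℂ) *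
      Polynomial.aeval (x : ℂ) (scaledLaguerre α (p.2 + p.1))) * z ^ p.2)

theorem hasSum_hilleHardyTerm_right {α : ℝ} (hα : -1 < α) (x y : ℝ) {z : ℂ} (hz : ‖z‖ < 1)
    (k : ℕ) : HasSum (fun n => hilleHardyTerm α x y z (k, n))
      ((-(y : ℂ) * z) ^ k / (Real.Gamma (α + k + 1) : ℂ) * laguerreGen α x k z) := by
  have h := (hasSum_laguerreGen hα x k hz).mul_left
    ((-(y : ℂ) * z) ^ k / (Real.Gamma (α + k + 1) : ℂ))
  exact h

theorem norm_hilleHardyTerm_le {α : ℝ} (hα : -1 < α) (x y : ℝ) (z : ℂ) (p : ℕ × ℕ) :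
    ‖hilleHardyTerm α x y z p‖ ≤ ‖hilleHardyTerm α (-|x|) (-|y|) (‖z‖ : ℝ) p‖ := by
  simp only [hilleHardyTerm, norm_mul, norm_div, norm_pow, aeval_ofReal_scaledLaguerre,
    Complex.norm_real, norm_neg, Real.norm_eq_abs, abs_norm, abs_abs]
  gcongr _ * (_ * (_ * ?_) * _)
  exact (abs_eval_scaledLaguerre_le hα _ x).trans (le_abs_self _)

theorem hilleHardyTerm_eq_norm {α : ℝ} (hα : -1 < α) (x y r : ℝ) (hr : 0 ≤ r) (p : ℕ × ℕ) :
    hilleHardyTerm α (-|x|) (-|y|) r p = (‖hilleHardyTerm α (-|x|) (-|y|) r p‖ : ℝ) := by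
  have h1 := (abs_nonneg _).trans (abs_eval_scaledLaguerre_le hα (p.2 + p.1) x)
  have h2 := laguerreWeight_pos hα (p.2 + p.1)
  have h3 := gamma_pos hα p.1
  have h : hilleHardyTerm α (-|x|) (-|y|) r p = (((|y| * r) ^ p.1 / Real.Gamma (α + p.1 + 1) *
      (((p.2 + p.1).choose p.1 : ℝ) * (laguerreWeight α (p.2 + p.1) *
      (scaledLaguerre α (p.2 + p.1)).eval (-|x|)) * r ^ p.2) : ℝ) : ℂ) := by
    rw [hilleHardyTerm, aeval_ofReal_scaledLaguerre]
    push_cast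
    simp
  rw [h, Complex.norm_real, Real.norm_of_nonneg (by positivity)]

/-- Replacing `x, y, z` by `-|x|, -|y|, ‖z‖` makes all terms nonnegative and dominates the original
ones. The row sums are then known in closed form, and their series converges because it is the
kernel expansion at these new arguments. -/
theorem summable_hilleHardyTerm {α : ℝ} (hα : -1 < α) (x y : ℝ) {z : ℂ} (hz : ‖z‖ < 1) :
    Summable (hilleHardyTerm α x y z) := by
  refine Summable.of_norm (Summable.of_nonneg_of_le (fun _ => norm_nonneg _)
    (norm_hilleHardyTerm_le hα x y z) ?_)
  have hz' : ‖((‖z‖ : ℝ) : ℂ)‖ < 1 := by simpa using hz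
  have hr := fun k => hasSum_hilleHardyTerm_right hα (-|x|) (-|y|) hz' k
  have hs := (hasSum_laguerreGen_eq_kernelC hα (-|x|) (-|y|) hz').summable
  rw [summable_prod_of_nonneg fun _ => norm_nonneg _]
  refine ⟨fun k => (hr k).summable.norm, ?_⟩
  rw [← Complex.summable_ofReal]
  convert hs using 1
  funext k
  rw [Complex.ofReal_tsum, ← (hr k).tsum_eq]
  exact tsum_congr fun n => (hilleHardyTerm_eq_norm hα x y _ (norm_nonneg z) (k, n)).symm

/-- The Hille–Hardy formula. -/
theorem hasSum_kernelC {α : ℝ} (hα : -1 < α) (x y : ℝ) {z : ℂ} (hz : ‖z‖ < 1) :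
    HasSum (fun n : ℕ => ((laguerreWeight α n * (scaledLaguerre α n).eval x *
      (scaledLaguerre α n).eval y : ℝ) : ℂ) * z ^ n) (kernelC α x y z) := by
  have hs := (summable_hilleHardyTerm hα x y hz).hasSum
  have hK := (hs.prod_fiberwise fun k => hasSum_hilleHardyTerm_right hα x y hz k).unique
    (hasSum_laguerreGen_eq_kernelC hα x y hz)
  rw [hK] at hs
  -- Regroup by the total power of `z`. On the antidiagonal `k + m = n` the factors `C(n,k) (-y)^k /
  -- Γ(α+k+1)` sum to the polynomial in `y`.
  have h := ((Finset.HasAntidiagonal.sigmaAntidiagonalEquivProd (A := ℕ)).hasSum_iff.2 hs).sigma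
    fun N => hasSum_fintype _
  have he : (fun n : ℕ => ((laguerreWeight α n * (scaledLaguerre α n).eval x *
      (scaledLaguerre α n).eval y : ℝ) : ℂ) * z ^ n) = fun n : ℕ =>
      ∑ p ∈ Finset.HasAntidiagonal.antidiagonal n, hilleHardyTerm α x y z p := by
    funext n
    rw [Finset.Nat.sum_antidiagonal_eq_sum_range_succ (fun i j => hilleHardyTerm α x y z (i, j)),
      eval_scaledLaguerre α n y, Complex.ofReal_mul, Complex.ofReal_sum, Finset.mul_sum,
      Finset.sum_mul]
    refine Finset.sum_congr rfl fun j hj => ?_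
    have hj' : n - j + j = n := Nat.sub_add_cancel (Nat.lt_succ_iff.1 (Finset.mem_range.1 hj))
    simp only [hilleHardyTerm, hj', aeval_ofReal_scaledLaguerre]
    rw [mul_pow, show z ^ n = z ^ (n - j) * z ^ j by rw [← pow_add, hj']]
    push_cast
    ring
  rw [he]
  refine Eq.mp (congrArg (HasSum · _) (funext fun n => ?_)) h
  exact Finset.sum_coe_sort _ (hilleHardyTerm α x y z)

/-! ### Orthogonality of the Laguerre polynomials -/

theorem integrable_laguerreMeasure_iff {E : Type*} [NormedAddCommGroup E] [NormedSpace ℝ E]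
    (α : ℝ) (f : ℝ → E) : Integrable f (laguerreMeasure α) ↔
      IntegrableOn (fun x => (x ^ α * Real.exp (-x)) • f x) (Ioi 0) := by
  rw [laguerreMeasure, integrable_withDensity_iff_integrable_smul' (by fun_prop) (by simp)]
  refine integrable_congr ((ae_restrict_mem measurableSet_Ioi).mono fun x hx => ?_)
  have hx' : (0 : ℝ) < x := hx
  simp only
  rw [ENNReal.toReal_ofReal (by positivity)]

theorem integral_laguerreMeasure {E : Type*} [NormedAddCommGroup E] [NormedSpace ℝ E]
    (α : ℝ) (f : ℝ → E) : ∫ x, f x ∂(laguerreMeasure α) =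
      ∫ x in Ioi 0, (x ^ α * Real.exp (-x)) • f x := by
  rw [laguerreMeasure, integral_withDensity_eq_integral_toReal_smul (by fun_prop) (by simp)]
  refine integral_congr_ae ((ae_restrict_mem measurableSet_Ioi).mono fun x hx => ?_)
  have hx' : (0 : ℝ) < x := hx
  simp only
  rw [ENNReal.toReal_ofReal (by positivity)]

theorem laguerre_rpow_mul_pow (α : ℝ) (k : ℕ) {x : ℝ} (hx : 0 < x) :
    (x ^ α * Real.exp (-x)) • x ^ k = Real.exp (-x) * x ^ (α + k + 1 - 1) := by
  rw [add_sub_cancel_right, Real.rpow_add hx, Real.rpow_natCast, smul_eq_mul]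
  ring

theorem integrable_pow_laguerreMeasure {α : ℝ} (hα : -1 < α) (k : ℕ) :
    Integrable (fun x : ℝ => x ^ k) (laguerreMeasure α) := by
  rw [integrable_laguerreMeasure_iff]
  have h : (0 : ℝ) < α + k + 1 := by have : (0 : ℝ) ≤ k := k.cast_nonneg; linarith
  exact (Real.GammaIntegral_convergent h).congr_fun
    (fun x hx => (laguerre_rpow_mul_pow α k hx).symm) measurableSet_Ioi

theorem integral_pow_laguerreMeasure {α : ℝ} (hα : -1 < α) (k : ℕ) :
    ∫ x, x ^ k ∂(laguerreMeasure α) = Real.Gamma (α + k + 1) := by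
  have h : (0 : ℝ) < α + k + 1 := by have : (0 : ℝ) ≤ k := k.cast_nonneg; linarith
  rw [integral_laguerreMeasure, Real.Gamma_eq_integral h]
  exact setIntegral_congr_fun measurableSet_Ioi fun x hx => laguerre_rpow_mul_pow α k hx

theorem integrable_polynomial_laguerreMeasure {α : ℝ} (hα : -1 < α) (p : Polynomial ℝ) :
    Integrable (fun x => p.eval x) (laguerreMeasure α) := by
  simp only [Polynomial.eval_eq_sum_range]
  exact integrable_finsetSum _ fun k _ => (integrable_pow_laguerreMeasure hα k).const_mul _

/-- The point is that this quotient is a polynomial in `j` of degree `k`, which finite differences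
can annihilate. -/
theorem gamma_div_gamma {α : ℝ} (hα : -1 < α) (j k : ℕ) :
    Real.Gamma (α + (j + k : ℕ) + 1) / Real.Gamma (α + j + 1) =
      ((ascPochhammer ℝ k).comp (Polynomial.X + Polynomial.C (α + 1))).eval (j : ℝ) := by
  have hj := (gamma_pos hα j).ne'
  induction k with
  | zero => simp [hj]
  | succ k ih =>
    rw [← add_assoc, gamma_succ hα (j + k), mul_div_assoc, ih, ascPochhammer_succ_right]
    simp only [Polynomial.eval_comp, Polynomial.mul_comp, Polynomial.eval_mul,
      Polynomial.add_comp, Polynomial.X_comp, Polynomial.natCast_comp, Polynomial.eval_add,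
      Polynomial.eval_X, Polynomial.eval_C, Polynomial.eval_natCast]
    push_cast
    ring

/-- Each moment is a Gamma value, so the integral is an alternating binomial sum of the polynomial
from `gamma_div_gamma`, that is, an `n`-th difference at `0`. It vanishes when `k < n` and is `±n!`
when `k = n`. -/
theorem integral_pow_mul_scaledLaguerre {α : ℝ} (hα : -1 < α) (k n : ℕ) :
    ∫ x, x ^ k * (scaledLaguerre α n).eval x ∂(laguerreMeasure α) = (-1) ^ n *
      (fwdDiff 1)^[n] ((ascPochhammer ℝ k).comp (Polynomial.X + Polynomial.C (α + 1))).eval 0 := by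
  rw [fwdDiff_iter_eq_sum_shift]
  simp only [eval_scaledLaguerre, Finset.mul_sum]
  rw [integral_finsetSum]
  · refine Finset.sum_congr rfl fun j hj => ?_
    have hj' : j ≤ n := Nat.lt_succ_iff.1 (Finset.mem_range.1 hj)
    have he : ∀ x : ℝ, x ^ k * ((n.choose j : ℝ) * (-x) ^ j / Real.Gamma (α + j + 1)) =
        ((-1) ^ j * n.choose j / Real.Gamma (α + j + 1)) * x ^ (j + k) := by
      intro x
      rw [neg_pow x, pow_add]
      ring
    simp only [he]
    rw [integral_const_mul, integral_pow_laguerreMeasure hα, nsmul_eq_mul, mul_one, zero_add,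
      ← gamma_div_gamma hα, zsmul_eq_mul]
    have hs : (-1 : ℝ) ^ n * (-1) ^ (n - j) = (-1) ^ j := by
      have h1 : (-1 : ℝ) ^ n = (-1) ^ j * (-1) ^ (n - j) := by rw [← pow_add]; congr 1; omega
      have h2 : (-1 : ℝ) ^ (n - j) * (-1) ^ (n - j) = 1 := by
        rw [← mul_pow]; norm_num
      rw [h1, mul_assoc, h2, mul_one]
    push_cast
    rw [← hs]
    ring
  · intro j _
    have h := (integrable_polynomial_laguerreMeasure hα
      (Polynomial.X ^ k * (Polynomial.C (n.choose j : ℝ) * (-Polynomial.X) ^ j *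
        Polynomial.C (Real.Gamma (α + j + 1))⁻¹)))
    simpa [div_eq_mul_inv] using h

theorem natDegree_ascPochhammer_comp (k : ℕ) (c : ℝ) :
    ((ascPochhammer ℝ k).comp (Polynomial.X + Polynomial.C c)).natDegree = k := by
  rw [Polynomial.natDegree_comp, ascPochhammer_natDegree, Polynomial.natDegree_X_add_C, mul_one]

theorem integral_pow_mul_scaledLaguerre_of_lt {α : ℝ} (hα : -1 < α) {k n : ℕ} (h : k < n) :
    ∫ x, x ^ k * (scaledLaguerre α n).eval x ∂(laguerreMeasure α) = 0 := by
  rw [integral_pow_mul_scaledLaguerre hα, Polynomial.fwdDiff_iter_eq_zero_of_degree_lt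
    (by rwa [natDegree_ascPochhammer_comp])]
  simp

theorem integral_pow_self_mul_scaledLaguerre {α : ℝ} (hα : -1 < α) (n : ℕ) :
    ∫ x, x ^ n * (scaledLaguerre α n).eval x ∂(laguerreMeasure α) = (-1) ^ n * n.factorial := by
  rw [integral_pow_mul_scaledLaguerre hα]
  have h := Polynomial.fwdDiff_iter_degree_eq_factorial
    ((ascPochhammer ℝ n).comp (Polynomial.X + Polynomial.C (α + 1)))
  rw [natDegree_ascPochhammer_comp,
    ((monic_ascPochhammer ℝ n).comp_X_add_C (α + 1)).leadingCoeff] at h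
  rw [h]
  simp

theorem integral_scaledLaguerre_mul {α : ℝ} (hα : -1 < α) {m n : ℕ} (h : m ≤ n) :
    ∫ x, (scaledLaguerre α m).eval x * (scaledLaguerre α n).eval x ∂(laguerreMeasure α) =
      if m = n then (laguerreWeight α n)⁻¹ else 0 := by
  have he : ∀ x : ℝ, (scaledLaguerre α m).eval x * (scaledLaguerre α n).eval x =
      ∑ j ∈ Finset.range (m + 1), ((-1) ^ j * m.choose j / Real.Gamma (α + j + 1)) *
        (x ^ j * (scaledLaguerre α n).eval x) := by
    intro x
    rw [eval_scaledLaguerre α m, Finset.sum_mul]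
    refine Finset.sum_congr rfl fun j _ => ?_
    rw [neg_pow x]
    ring
  simp only [he]
  rw [integral_finsetSum]
  · simp only [integral_const_mul]
    rw [Finset.sum_range_succ, Finset.sum_eq_zero, zero_add]
    · split_ifs with hmn
      · subst hmn
        rw [integral_pow_self_mul_scaledLaguerre hα, Nat.choose_self, laguerreWeight, inv_div]
        have : (-1 : ℝ) ^ m * (-1) ^ m = 1 := by rw [← mul_pow]; norm_num
        push_cast
        linear_combination ((m.factorial : ℝ) / Real.Gamma (α + m + 1)) * this
      · rw [integral_pow_mul_scaledLaguerre_of_lt hα (lt_of_le_of_ne h hmn), mul_zero]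
    · intro j hj
      rw [integral_pow_mul_scaledLaguerre_of_lt hα ((Finset.mem_range.1 hj).trans_le h), mul_zero]
  · intro j _
    have := integrable_polynomial_laguerreMeasure hα (Polynomial.X ^ j * scaledLaguerre α n)
    exact (by simpa using this : Integrable _ _).const_mul _

/-- The orthonormal Laguerre polynomials. -/
def laguerreFun (α : ℝ) (n : ℕ) (x : ℝ) : ℝ :=
  Real.sqrt (laguerreWeight α n) * (scaledLaguerre α n).eval x

theorem laguerreFun_mul {α : ℝ} (hα : -1 < α) (n : ℕ) (x y : ℝ) :
    laguerreFun α n x * laguerreFun α n y =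
      laguerreWeight α n * (scaledLaguerre α n).eval x * (scaledLaguerre α n).eval y := by
  have h := Real.mul_self_sqrt (laguerreWeight_pos hα n).le
  rw [laguerreFun, laguerreFun]
  linear_combination ((scaledLaguerre α n).eval x * (scaledLaguerre α n).eval y) * h

theorem continuous_laguerreFun (α : ℝ) (n : ℕ) : Continuous (laguerreFun α n) :=
  continuous_const.mul (scaledLaguerre α n).continuous

theorem memLp_laguerreFun {α : ℝ} (hα : -1 < α) (n : ℕ) :
    MemLp (laguerreFun α n) 2 (laguerreMeasure α) := by
  rw [memLp_two_iff_integrable_sq (continuous_laguerreFun α n).aestronglyMeasurable]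
  have h := (integrable_polynomial_laguerreMeasure hα
    (scaledLaguerre α n * scaledLaguerre α n)).const_mul (laguerreWeight α n)
  refine h.congr (Filter.Eventually.of_forall fun x => ?_)
  simp only [Polynomial.eval_mul]
  rw [sq, laguerreFun_mul hα, mul_assoc]

theorem integral_laguerreFun_mul {α : ℝ} (hα : -1 < α) (m n : ℕ) :
    ∫ x, laguerreFun α m x * laguerreFun α n x ∂(laguerreMeasure α) = if m = n then 1 else 0 := by
  wlog h : m ≤ n generalizing m n
  · have := this n m (le_of_not_ge h)
    simp only [mul_comm (laguerreFun α n _)] at this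
    rw [this]
    simp only [eq_comm]
  have he : ∀ x, laguerreFun α m x * laguerreFun α n x =
      (Real.sqrt (laguerreWeight α m) * Real.sqrt (laguerreWeight α n)) *
        ((scaledLaguerre α m).eval x * (scaledLaguerre α n).eval x) := fun x => by
    rw [laguerreFun, laguerreFun]; ring
  simp only [he]
  rw [integral_const_mul, integral_scaledLaguerre_mul hα h]
  split_ifs with hmn
  · subst hmn
    rw [Real.mul_self_sqrt (laguerreWeight_pos hα m).le,
      mul_inv_cancel₀ (laguerreWeight_pos hα m).ne']
  · simp

/-! ### Bessel's inequality for vector-valued functions -/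

theorem integrable_smul_of_memLp_two {X E : Type*} [MeasurableSpace X] {μ : Measure X}
    [NormedAddCommGroup E] [NormedSpace ℝ E] {ψ : X → ℝ} {φ : X → E} (hψ : MemLp ψ 2 μ)
    (hφ : MemLp φ 2 μ) : Integrable (fun x => ψ x • φ x) μ :=
  memLp_one_iff_integrable.1 (hφ.smul hψ)

/-- Bessel's inequality for vector-valued functions and a real orthonormal system. -/
theorem sum_norm_integral_smul_sq_le {X E ι : Type*} [MeasurableSpace X] {μ : Measure X}
    [NormedAddCommGroup E] [InnerProductSpace ℝ E] [CompleteSpace E]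
    [DecidableEq ι] {ψ : ι → X → ℝ} (hψ : ∀ i, MemLp (ψ i) 2 μ)
    (ho : ∀ i j, ∫ x, ψ i x * ψ j x ∂μ = if i = j then 1 else 0)
    {φ : X → E} (hφ : MemLp φ 2 μ) (s : Finset ι) :
    ∑ i ∈ s, ‖∫ x, ψ i x • φ x ∂μ‖ ^ 2 ≤ ∫ x, ‖φ x‖ ^ 2 ∂μ := by
  set a : ι → E := fun i => ∫ x, ψ i x • φ x ∂μ
  have h1 : ∀ i, Integrable (fun x => ψ i x • φ x) μ := fun i => integrable_smul_of_memLp_two (hψ i) hφ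
  have h2 : ∀ i j, Integrable (fun x => ψ i x * ψ j x) μ := fun i j =>
    (hψ i).integrable_mul (hψ j)
  have he : ∀ x, ‖φ x - ∑ i ∈ s, ψ i x • a i‖ ^ 2 = ‖φ x‖ ^ 2 -
      2 * ∑ i ∈ s, inner ℝ (a i) (ψ i x • φ x) +
        ∑ i ∈ s, ∑ j ∈ s, (ψ i x * ψ j x) * inner ℝ (a i) (a j) := by
    intro x
    rw [norm_sub_sq_real, ← real_inner_self_eq_norm_sq (∑ i ∈ s, ψ i x • a i)]
    simp only [inner_sum, sum_inner, inner_smul_left, inner_smul_right]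
    congr 1
    · congr 2
      refine Finset.sum_congr rfl fun i _ => ?_
      rw [real_inner_comm]
    · rw [Finset.sum_comm]
      refine Finset.sum_congr rfl fun i _ => ?_
      rw [Finset.mul_sum]
      refine Finset.sum_congr rfl fun j _ => ?_
      rw [conj_trivial]
      ring
  have hi1 : Integrable (fun x => ‖φ x‖ ^ 2) μ := hφ.integrable_norm_pow two_ne_zero
  have hi2 : Integrable (fun x => ∑ i ∈ s, inner ℝ (a i) (ψ i x • φ x)) μ :=
    integrable_finsetSum _ fun i _ => (h1 i).const_inner _
  have hi3 : Integrable (fun x => ∑ i ∈ s, ∑ j ∈ s, (ψ i x * ψ j x) * inner ℝ (a i) (a j)) μ :=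
    integrable_finsetSum _ fun i _ => integrable_finsetSum _ fun j _ => (h2 i j).mul_const _
  -- The squared distance from `φ` to its projection is nonnegative; expanding it by orthonormality
  -- gives the inequality.
  have h0 : 0 ≤ ∫ x, ‖φ x - ∑ i ∈ s, ψ i x • a i‖ ^ 2 ∂μ := integral_nonneg fun x => by positivity
  simp only [he] at h0
  have h12 : Integrable (fun x => ‖φ x‖ ^ 2 - 2 * ∑ i ∈ s, inner ℝ (a i) (ψ i x • φ x)) μ :=
    hi1.sub (hi2.const_mul 2)
  rw [integral_add h12 hi3, integral_sub hi1 (hi2.const_mul 2),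
    integral_const_mul, integral_finsetSum _ fun i _ => (h1 i).const_inner _,
    integral_finsetSum _ fun i _ => integrable_finsetSum _ fun j _ => (h2 i j).mul_const _] at h0
  have h3 : ∀ i, ∫ x, inner ℝ (a i) (ψ i x • φ x) ∂μ = ‖a i‖ ^ 2 := fun i => by
    rw [integral_inner (h1 i), real_inner_self_eq_norm_sq]
  have h4 : ∀ i ∈ s, ∫ x, ∑ j ∈ s, (ψ i x * ψ j x) * inner ℝ (a i) (a j) ∂μ = ‖a i‖ ^ 2 := by
    intro i hi
    rw [integral_finsetSum _ fun j _ => (h2 i j).mul_const _]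
    simp only [integral_mul_const, ho]
    simp [hi]
  simp only [h3] at h0
  rw [Finset.sum_congr rfl h4] at h0
  linarith

/-! ### Growth of the Laguerre functions at a point `y > 0` -/

/-- The off-diagonal Jacobi parameter `√(n (n+α))` of the Laguerre polynomials. -/
def laguerreJacobi (α : ℝ) (n : ℕ) : ℝ := Real.sqrt (n * (n + α))

theorem laguerreJacobi_mul_sqrt_succ {α : ℝ} (hα : -1 < α) (n : ℕ) :
    laguerreJacobi α (n + 1) * Real.sqrt (laguerreWeight α (n + 1)) =
      (α + n + 1) * Real.sqrt (laguerreWeight α n) := by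
  have hn : (0 : ℝ) ≤ n := n.cast_nonneg
  have h1 : 0 ≤ α + n + 1 := by linarith
  rw [laguerreJacobi, ← Real.sqrt_mul (by push_cast; nlinarith),
    show ((n + 1 : ℕ) * ((n + 1 : ℕ) + α) * laguerreWeight α (n + 1) : ℝ) =
      (α + n + 1) ^ 2 * laguerreWeight α n by
        push_cast; linear_combination (α + n + 1) * laguerreWeight_succ hα n,
    Real.sqrt_mul (sq_nonneg _), Real.sqrt_sq h1]

theorem laguerreJacobi_mul_sqrt {α : ℝ} (hα : -1 < α) (n : ℕ) :
    laguerreJacobi α (n + 1) * Real.sqrt (laguerreWeight α n) =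
      (n + 1) * Real.sqrt (laguerreWeight α (n + 1)) := by
  have hn : (0 : ℝ) ≤ n := n.cast_nonneg
  have h1 : (0 : ℝ) ≤ n + 1 := by linarith
  rw [laguerreJacobi, ← Real.sqrt_mul (by push_cast; nlinarith),
    show ((n + 1 : ℕ) * ((n + 1 : ℕ) + α) * laguerreWeight α n : ℝ) =
      (n + 1) ^ 2 * laguerreWeight α (n + 1) by
        push_cast; linear_combination (-(n + 1 : ℝ)) * laguerreWeight_succ hα n,
    Real.sqrt_mul (sq_nonneg _), Real.sqrt_sq h1]

/-- Orthonormalization makes the recurrence symmetric: the same parameters `a_n` stand on both sides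
of the diagonal, so it becomes a difference equation in divergence form. -/
theorem laguerreFun_recurrence {α : ℝ} (hα : -1 < α) (n : ℕ) (y : ℝ) :
    laguerreJacobi α (n + 2) * laguerreFun α (n + 2) y =
      (2 * n + 3 + α - y) * laguerreFun α (n + 1) y -
        laguerreJacobi α (n + 1) * laguerreFun α n y := by
  have h := congrArg (Polynomial.eval y) (scaledLaguerre_recurrence hα n)
  simp only [Polynomial.eval_mul, Polynomial.eval_sub, Polynomial.eval_C, Polynomial.eval_X] at h
  have h1 := laguerreJacobi_mul_sqrt_succ hα (n + 1)
  have h2 := laguerreJacobi_mul_sqrt hα n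
  push_cast at h1
  simp only [laguerreFun]
  linear_combination Real.sqrt (laguerreWeight α (n + 1)) * h +
    (scaledLaguerre α (n + 2)).eval y * h1 + (scaledLaguerre α n).eval y * h2

theorem half_le_laguerreJacobi {α : ℝ} (hα : -1 < α) {n : ℕ} (hn : 2 ≤ n) :
    (n : ℝ) / 2 ≤ laguerreJacobi α n := by
  have h : (2 : ℝ) ≤ n := by exact_mod_cast hn
  apply Real.le_sqrt_of_sq_le
  nlinarith

theorem laguerreJacobi_sq {α : ℝ} (hα : -1 < α) {n : ℕ} (hn : 2 ≤ n) :
    laguerreJacobi α n ^ 2 = n * (n + α) := by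
  have h : (2 : ℝ) ≤ n := by exact_mod_cast hn
  exact Real.sq_sqrt (by nlinarith)

/-- The defect `n + α/2 - √(n(n+α))` is nonnegative and at most `α² / (2n)`. -/
theorem laguerreJacobi_defect {α : ℝ} (hα : -1 < α) {n : ℕ} (hn : 2 ≤ n) :
    0 ≤ n + α / 2 - laguerreJacobi α n ∧ n + α / 2 - laguerreJacobi α n ≤ α ^ 2 / (2 * n) := by
  have h : (2 : ℝ) ≤ n := by exact_mod_cast hn
  have h1 := half_le_laguerreJacobi hα hn
  have h2 := laguerreJacobi_sq hα hn
  set a := laguerreJacobi α n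
  -- Difference of squares: `(n + α/2)² - n(n+α) = α²/4`.
  have hs : (n + α / 2 - a) * (n + α / 2 + a) = α ^ 2 / 4 := by linear_combination -h2
  have hp : 0 < n + α / 2 + a := by linarith
  have h0 : 0 ≤ n + α / 2 - a := by
    by_contra hc
    have := mul_neg_of_neg_of_pos (not_le.1 hc) hp
    nlinarith [sq_nonneg α]
  refine ⟨h0, ?_⟩
  rw [le_div_iff₀ (by positivity)]
  nlinarith

/-- One step of the discrete energy estimate for a Jacobi recurrence. -/
theorem energy_step {a a' y V v p q r : ℝ} (ha : 0 < a) (haa : a ≤ a') (haa' : a' - a ≤ 4)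
    (hV : |V| ≤ v) (hv : v ≤ y) (hrec : a' * r = (a + a' + V - y) * q - a * p) :
    a' * (r - q) ^ 2 + y * r * q ≤ a * (q - p) ^ 2 + y * q * p +
      ((8 * y / a + 2 * v) * |q * (q - p)| + 2 * y * v / a * q ^ 2) := by
  have ha' : 0 < a' := ha.trans_le haa
  have hv0 : 0 ≤ v := (abs_nonneg V).trans hV
  have hy0 : 0 ≤ y := hv0.trans hv
  have hyV : |y - V| ≤ 2 * y := (abs_sub _ _).trans (by rw [abs_of_nonneg hy0]; linarith)
  set D := q - p with hD
  have hD' : r - q = (a / a') * D - (y - V) / a' * q := by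
    field_simp
    linear_combination hrec
  -- Multiply `a'(r-q) - aD = (V-y)q` by `(r-q) + D`. With the mixed product `y r q` in place of `y
  -- q²`, the terms in `y` telescope exactly.
  have hdiff : a' * (r - q) ^ 2 + y * r * q = a * D ^ 2 + y * q * p +
      (-(a' - a) * D * (r - q) + V * q * (D + (r - q))) := by
    linear_combination (r - q + D) * hrec
  have h1 : -(a' - a) * D * (r - q) ≤ 8 * y / a * |q * D| := by
    rw [hD']
    have e : -(a' - a) * D * (a / a' * D - (y - V) / a' * q) =
        -((a' - a) * (a / a') * D ^ 2) + (a' - a) / a' * ((y - V) * (q * D)) := by ring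
    rw [e]
    have k1 : 0 ≤ (a' - a) * (a / a') * D ^ 2 :=
      mul_nonneg (mul_nonneg (sub_nonneg.2 haa) (div_pos ha ha').le) (sq_nonneg _)
    have k2 : (y - V) * (q * D) ≤ 2 * y * |q * D| :=
      (le_abs_self _).trans (by rw [abs_mul]; gcongr)
    have k3 : (a' - a) / a' ≤ 4 / a := div_le_div₀ (by norm_num) haa' ha haa
    have k4 : (a' - a) / a' * ((y - V) * (q * D)) ≤ 4 / a * (2 * y * |q * D|) :=
      (mul_le_mul_of_nonneg_left k2 (div_nonneg (sub_nonneg.2 haa) ha'.le)).trans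
        (mul_le_mul_of_nonneg_right k3 (by positivity))
    have e2 : 4 / a * (2 * y * |q * D|) = 8 * y / a * |q * D| := by ring
    linarith
  have h2 : V * q * (D + (r - q)) ≤ 2 * v * |q * D| + 2 * y * v / a * q ^ 2 := by
    rw [hD']
    have e : V * q * (D + (a / a' * D - (y - V) / a' * q)) =
        V * (q * D) + a / a' * (V * (q * D)) - (y - V) / a' * V * q ^ 2 := by ring
    rw [e]
    have k1 : V * (q * D) ≤ v * |q * D| :=
      (le_abs_self _).trans (by rw [abs_mul]; gcongr)
    have k2 : a / a' * (V * (q * D)) ≤ v * |q * D| := by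
      calc a / a' * (V * (q * D)) ≤ a / a' * (v * |q * D|) :=
            mul_le_mul_of_nonneg_left k1 (div_pos ha ha').le
        _ ≤ 1 * (v * |q * D|) :=
            mul_le_mul_of_nonneg_right ((div_le_one ha').2 haa) (by positivity)
        _ = _ := one_mul _
    have k3 : -((y - V) / a' * V * q ^ 2) ≤ 2 * y * v / a * q ^ 2 := by
      have : -((y - V) / a' * V) ≤ 2 * y * v / a := by
        refine (neg_le_abs _).trans ?_
        rw [abs_mul, abs_div, abs_of_pos ha', div_mul_eq_mul_div]
        exact div_le_div₀ (by positivity) (by gcongr) ha haa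
      have := mul_le_mul_of_nonneg_right this (sq_nonneg q)
      linarith
    linarith
  rw [hdiff]
  linarith

/-- Write `2qp = q² + p² - (q-p)²`; the negative part is absorbed as `y ≤ a`. -/
theorem energy_lower {a y p q : ℝ} (hy : 0 ≤ y) (ha : y ≤ a) :
    a / 2 * (q - p) ^ 2 + y / 2 * q ^ 2 ≤ a * (q - p) ^ 2 + y * q * p := by
  nlinarith [mul_nonneg hy (sq_nonneg p), mul_nonneg (sub_nonneg.2 ha) (sq_nonneg (q - p))]

/-- The discrete energy of the Laguerre recurrence at `y`. -/
def laguerreEnergy (α y : ℝ) (n : ℕ) : ℝ :=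
  laguerreJacobi α (n + 1) * (laguerreFun α (n + 1) y - laguerreFun α n y) ^ 2 +
    y * laguerreFun α (n + 1) y * laguerreFun α n y

theorem eventually_le_laguerreEnergy {α : ℝ} (hα : -1 < α) {y : ℝ} (hy : 0 < y) :
    ∀ᶠ n : ℕ in Filter.atTop, laguerreJacobi α (n + 1) / 2 *
      (laguerreFun α (n + 1) y - laguerreFun α n y) ^ 2 + y / 2 * laguerreFun α (n + 1) y ^ 2 ≤
        laguerreEnergy α y n := by
  filter_upwards [Filter.eventually_ge_atTop 1, tendsto_natCast_atTop_atTop.eventually_ge_atTop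
    (2 * y)] with n h1 h2
  have := half_le_laguerreJacobi hα (show 2 ≤ n + 1 by omega)
  push_cast at this
  exact energy_lower hy.le (by linarith)

/-- The first two bounds use `(a' - a)(a' + a) = 2n + 3 + α` and `a + a' ≥ n + 3/2`. The third
quantity is the sum of the two defects from `laguerreJacobi_defect`. -/
theorem laguerreJacobi_succ_bounds {α : ℝ} (hα : -1 < α) {n : ℕ} (hn : 1 ≤ n)
    (hnα : 1 + |α| ≤ n) :
    laguerreJacobi α (n + 1) ≤ laguerreJacobi α (n + 1 + 1) ∧
      laguerreJacobi α (n + 1 + 1) - laguerreJacobi α (n + 1) ≤ 4 ∧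
      |2 * (n : ℝ) + 3 + α - laguerreJacobi α (n + 1) - laguerreJacobi α (n + 1 + 1)| ≤
        α ^ 2 / (n + 1) := by
  have hn1 : (1 : ℝ) ≤ n := by exact_mod_cast hn
  obtain ⟨c1, c2⟩ := laguerreJacobi_defect hα (show 2 ≤ n + 1 by omega)
  obtain ⟨c3, c4⟩ := laguerreJacobi_defect hα (show 2 ≤ n + 1 + 1 by omega)
  have b1 := half_le_laguerreJacobi hα (show 2 ≤ n + 1 by omega)
  have b2 := half_le_laguerreJacobi hα (show 2 ≤ n + 1 + 1 by omega)
  have s1 := laguerreJacobi_sq hα (show 2 ≤ n + 1 by omega)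
  have s2 := laguerreJacobi_sq hα (show 2 ≤ n + 1 + 1 by omega)
  push_cast at b1 b2 s1 s2 c1 c2 c3 c4
  set a := laguerreJacobi α (n + 1)
  set a' := laguerreJacobi α (n + 1 + 1)
  have hs : (a' - a) * (a' + a) = 2 * n + 3 + α := by linear_combination s2 - s1
  have hp : 0 < a' + a := by linarith
  have hab := le_abs_self α
  refine ⟨?_, ?_, ?_⟩
  · by_contra hc
    have := mul_neg_of_neg_of_pos (sub_neg.2 (not_le.1 hc)) hp
    linarith
  · by_contra hc
    have := mul_lt_mul_of_pos_right (not_le.1 hc) hp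
    linarith
  · have hc4 : α ^ 2 / (2 * ((n : ℝ) + 1 + 1)) ≤ α ^ 2 / (2 * (n + 1)) := by gcongr; linarith
    have : α ^ 2 / ((n : ℝ) + 1) = 2 * (α ^ 2 / (2 * (n + 1))) := by field_simp
    rw [this, abs_of_nonneg (by linarith)]
    linarith

/-- The energy controls `q²` by a multiple of `E` and `(q-p)²` by a multiple of `E/n`, so `|q(q-p)|`
is `O(n^{-1/2}) E`. The error in `energy_step` is `O(1/n)|q(q-p)| + O(1/n²) q²`, hence `o(1/n) E`.
-/
theorem eventually_laguerreEnergy_succ_le {α : ℝ} (hα : -1 < α) {y : ℝ} (hy : 0 < y) {ε : ℝ}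
    (hε : 0 < ε) : ∀ᶠ n : ℕ in Filter.atTop,
      laguerreEnergy α y (n + 1) ≤ (1 + ε / (n + 1)) * laguerreEnergy α y n := by
  have hlim : Filter.Tendsto (fun n : ℕ => (16 * y + 2 * α ^ 2) * Real.sqrt (8 / y / ((n : ℝ) + 1)) +
      8 * α ^ 2 * (1 / ((n : ℝ) + 1))) Filter.atTop (nhds 0) := by
    have h1 := tendsto_one_div_add_atTop_nhds_zero_nat (𝕜 := ℝ)
    have h2 : Filter.Tendsto (fun n : ℕ => Real.sqrt (8 / y / ((n : ℝ) + 1))) Filter.atTop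
        (nhds 0) := by
      have := (h1.const_mul (8 / y)).sqrt
      simpa [div_eq_mul_inv] using this
    simpa using (h2.const_mul (16 * y + 2 * α ^ 2)).add (h1.const_mul (8 * α ^ 2))
  filter_upwards [eventually_le_laguerreEnergy hα hy, hlim.eventually_le_const hε,
    Filter.eventually_ge_atTop 1,
    tendsto_natCast_atTop_atTop.eventually_ge_atTop (α ^ 2 / y),
    tendsto_natCast_atTop_atTop.eventually_ge_atTop (1 + |α|)] with n hE hsmall hn hny hnα
  have hn1 : (1 : ℝ) ≤ n := by exact_mod_cast hn
  have hN : (0 : ℝ) < n + 1 := by positivity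
  have b1 := half_le_laguerreJacobi hα (show 2 ≤ n + 1 by omega)
  obtain ⟨haa, haa', hV⟩ := laguerreJacobi_succ_bounds hα hn hnα
  have hrec := laguerreFun_recurrence hα n y
  rw [laguerreEnergy] at hE ⊢
  push_cast at b1
  rw [show n + 2 = n + 1 + 1 by rfl] at hrec
  set a := laguerreJacobi α (n + 1)
  set a' := laguerreJacobi α (n + 1 + 1)
  set p := laguerreFun α n y
  set q := laguerreFun α (n + 1) y
  set r := laguerreFun α (n + 1 + 1) y
  have ha : 0 < a := by linarith
  have hv : α ^ 2 / ((n : ℝ) + 1) ≤ y := by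
    rw [div_le_iff₀ hN]
    rw [div_le_iff₀ hy] at hny
    nlinarith
  have hstep := energy_step (p := p) (q := q) (r := r) ha haa haa' hV hv (by
    linear_combination hrec)
  rw [laguerreEnergy]
  change a' * (r - q) ^ 2 + y * r * q ≤ _ * (a * (q - p) ^ 2 + y * q * p)
  change _ ≤ a * (q - p) ^ 2 + y * q * p at hE
  set E := a * (q - p) ^ 2 + y * q * p
  have hE0 : 0 ≤ E := le_trans (by positivity) hE
  have hq : q ^ 2 ≤ 2 / y * E := by
    rw [div_mul_eq_mul_div, le_div_iff₀ hy]
    nlinarith [mul_nonneg ha.le (sq_nonneg (q - p))]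
  have hD : (q - p) ^ 2 ≤ 4 / (n + 1) * E := by
    rw [div_mul_eq_mul_div, le_div_iff₀ hN]
    nlinarith [mul_nonneg hy.le (sq_nonneg q), mul_nonneg (sub_nonneg.2 b1) (sq_nonneg (q - p))]
  have hqD : |q * (q - p)| ≤ Real.sqrt (8 / y / (n + 1)) * E := by
    rw [← Real.sqrt_sq hE0, ← Real.sqrt_mul (by positivity)]
    apply Real.le_sqrt_of_sq_le
    rw [sq_abs, mul_pow]
    calc q ^ 2 * (q - p) ^ 2 ≤ (2 / y * E) * (4 / (n + 1) * E) :=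
          mul_le_mul hq hD (sq_nonneg _) (by positivity)
      _ = _ := by field_simp; ring
  have ha2 : 1 / a ≤ 2 / (n + 1) := by
    rw [div_le_div_iff₀ ha hN]
    linarith
  have hf1 : 8 * y / a + 2 * (α ^ 2 / (n + 1)) ≤ (16 * y + 2 * α ^ 2) / (n + 1) := by
    have : 8 * y / a ≤ 8 * y * (2 / (n + 1)) := by
      rw [← mul_one_div]; gcongr
    calc _ ≤ 8 * y * (2 / (n + 1)) + 2 * (α ^ 2 / (n + 1)) := by linarith
      _ = _ := by ring
  have hf2 : 2 * y * (α ^ 2 / (n + 1)) / a ≤ y / 2 * (8 * α ^ 2 * (1 / (n + 1))) / (n + 1) := by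
    rw [← mul_one_div _ a]
    calc _ ≤ 2 * y * (α ^ 2 / (n + 1)) * (2 / (n + 1)) := by gcongr
      _ = _ := by ring
  have hA : (8 * y / a + 2 * (α ^ 2 / (n + 1))) * |q * (q - p)| ≤
      (16 * y + 2 * α ^ 2) / (n + 1) * (Real.sqrt (8 / y / (n + 1)) * E) :=
    mul_le_mul hf1 hqD (abs_nonneg _) (by positivity)
  have hB : 2 * y * (α ^ 2 / (n + 1)) / a * q ^ 2 ≤
      y / 2 * (8 * α ^ 2 * (1 / (n + 1))) / (n + 1) * (2 / y * E) :=
    mul_le_mul hf2 hq (sq_nonneg _) (by positivity)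
  have hC : (16 * y + 2 * α ^ 2) / (n + 1) * (Real.sqrt (8 / y / (n + 1)) * E) +
      y / 2 * (8 * α ^ 2 * (1 / (n + 1))) / (n + 1) * (2 / y * E) =
      ((16 * y + 2 * α ^ 2) * Real.sqrt (8 / y / (n + 1)) + 8 * α ^ 2 * (1 / (n + 1))) *
        (E / (n + 1)) := by
    have hy1 : y / 2 * (2 / y) = 1 := by field_simp
    linear_combination (8 * α ^ 2 * (1 / (n + 1)) / (n + 1) * E : ℝ) * hy1
  have hF := mul_le_mul_of_nonneg_right hsmall (by positivity : 0 ≤ E / ((n : ℝ) + 1))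
  calc _ ≤ _ := hstep
    _ ≤ E + ε * (E / (n + 1)) := by linarith
    _ = _ := by ring

/-- For `y > 0`, the values of the Laguerre functions at `y` are bounded relative to any sequence
decaying like a positive power of `n`. -/
theorem exists_laguerreFun_sq_mul_le {α : ℝ} (hα : -1 < α) {y : ℝ} (hy : 0 < y) {β η : ℝ}
    (hβ : 0 < β) (hη : 0 < η) {M : ℕ → ℝ} (hM : ∀ n, 0 ≤ M n)
    (hrec : ∀ n, (n + β + η) * M (n + 1) = (n + β) * M n) :
    ∃ C, ∀ n, laguerreFun α n y ^ 2 * M n ≤ C := by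
  -- Small enough that `1 + ε/(n+1)` is beaten by the ratio `(n+1+β)/(n+1+β+η)` of consecutive `M`
  -- for every `n ≥ 0`.
  have hε : 0 < η / (1 + β + η) := by positivity
  obtain ⟨n₀, h⟩ := Filter.eventually_atTop.1 ((eventually_le_laguerreEnergy hα hy).and
    (eventually_laguerreEnergy_succ_le hα hy hε))
  have hE0 : ∀ n ≥ n₀, 0 ≤ laguerreEnergy α y n := fun n hn =>
    le_trans (add_nonneg (mul_nonneg (div_nonneg (Real.sqrt_nonneg _) (by norm_num))
      (sq_nonneg _)) (by positivity)) (h n hn).1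
  have hG : ∀ n ≥ n₀, laguerreEnergy α y n * M (n + 1) ≤ laguerreEnergy α y n₀ * M (n₀ + 1) := by
    intro n hn
    induction n, hn using Nat.le_induction with
    | base => exact le_rfl
    | succ n hn ih =>
      refine le_trans ?_ ih
      have hr := hrec (n + 1)
      push_cast at hr
      have hn0 : (0 : ℝ) ≤ n := n.cast_nonneg
      have hM' : M (n + 1 + 1) = (n + 1 + β) / (n + 1 + β + η) * M (n + 1) := by
        rw [div_mul_eq_mul_div, eq_div_iff (by positivity)]
        linarith
      have hfac : (1 + η / (1 + β + η) / (n + 1)) * ((n + 1 + β) / (n + 1 + β + η)) ≤ 1 := by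
        rw [div_div, ← sub_nonneg]
        have : 1 - (1 + η / ((1 + β + η) * (n + 1))) * ((n + 1 + β) / (n + 1 + β + η)) =
            η * ((1 + β + η) * (n + 1) - (n + 1 + β)) /
              ((1 + β + η) * (n + 1) * (n + 1 + β + η)) := by
          field_simp
          ring
        rw [this]
        apply div_nonneg _ (by positivity)
        apply mul_nonneg hη.le
        nlinarith [mul_nonneg hn0 hβ.le, mul_nonneg hn0 hη.le]
      calc laguerreEnergy α y (n + 1) * M (n + 1 + 1)
          ≤ ((1 + η / (1 + β + η) / (n + 1)) * laguerreEnergy α y n) * M (n + 1 + 1) :=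
            mul_le_mul_of_nonneg_right (h n hn).2 (hM _)
        _ = ((1 + η / (1 + β + η) / (n + 1)) * ((n + 1 + β) / (n + 1 + β + η))) *
              (laguerreEnergy α y n * M (n + 1)) := by rw [hM']; ring
        _ ≤ 1 * (laguerreEnergy α y n * M (n + 1)) :=
            mul_le_mul_of_nonneg_right hfac (mul_nonneg (hE0 n hn) (hM _))
        _ = _ := one_mul _
  have hev : ∀ᶠ n in Filter.atTop, laguerreFun α n y ^ 2 * M n ≤
      2 / y * (laguerreEnergy α y n₀ * M (n₀ + 1)) := by
    filter_upwards [Filter.eventually_ge_atTop (n₀ + 1)] with n hn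
    obtain ⟨m, rfl⟩ : ∃ m, n = m + 1 := ⟨n - 1, by omega⟩
    have hm : n₀ ≤ m := by omega
    have h1 := (h m hm).1
    have h2 : laguerreFun α (m + 1) y ^ 2 ≤ 2 / y * laguerreEnergy α y m := by
      rw [div_mul_eq_mul_div, le_div_iff₀ hy]
      have : 0 ≤ laguerreJacobi α (m + 1) / 2 *
          (laguerreFun α (m + 1) y - laguerreFun α m y) ^ 2 :=
        mul_nonneg (div_nonneg (Real.sqrt_nonneg _) (by norm_num)) (sq_nonneg _)
      linarith
    calc _ ≤ 2 / y * laguerreEnergy α y m * M (m + 1) := mul_le_mul_of_nonneg_right h2 (hM _)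
      _ = 2 / y * (laguerreEnergy α y m * M (m + 1)) := by ring
      _ ≤ _ := mul_le_mul_of_nonneg_left (hG m hm) (by positivity)
  obtain ⟨C, hC⟩ := (Filter.isBoundedUnder_of_eventually_le hev).bddAbove_range
  exact ⟨C, fun n => hC ⟨n, rfl⟩⟩

/-! ### Values at the origin -/

/-- The values of the Laguerre functions at the origin. -/
theorem laguerreFun_zero_sq {α : ℝ} (hα : -1 < α) (n : ℕ) :
    laguerreFun α n 0 ^ 2 = laguerreWeight α n / Real.Gamma (α + 1) ^ 2 := by
  have h : (scaledLaguerre α n).eval 0 = (Real.Gamma (α + 1))⁻¹ := by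
    rw [← Polynomial.coeff_zero_eq_eval_zero, coeff_scaledLaguerre]
    simp
  rw [sq, laguerreFun_mul hα, h]
  field_simp

/-- The sequence is nonincreasing: its ratio is at most `1` exactly when `α(n+β) ≤ η(n+1)`, which
follows from `α ≤ η` and `β ≤ 1`. -/
theorem laguerreFun_zero_sq_mul_le {α : ℝ} (hα : -1 < α) {β η : ℝ} (hβ : 0 < β) (hβ1 : β ≤ 1)
    (hη : 0 < η) (hαη : α ≤ η) {M : ℕ → ℝ} (hM : ∀ n, 0 ≤ M n)
    (hrec : ∀ n, (n + β + η) * M (n + 1) = (n + β) * M n) (n : ℕ) :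
    laguerreFun α n 0 ^ 2 * M n ≤ laguerreFun α 0 0 ^ 2 * M 0 := by
  induction n with
  | zero => exact le_rfl
  | succ n ih =>
    refine le_trans ?_ ih
    have hn0 : (0 : ℝ) ≤ n := n.cast_nonneg
    rw [laguerreFun_zero_sq hα, laguerreFun_zero_sq hα, div_mul_eq_mul_div, div_mul_eq_mul_div]
    gcongr ?_ / _
    have h1 := laguerreWeight_succ hα n
    have h2 := hrec n
    have hg := laguerreWeight_pos hα n
    have e1 : laguerreWeight α (n + 1) = (α + n + 1) / (n + 1) * laguerreWeight α n := by
      field_simp; linarith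
    have e2 : M (n + 1) = (n + β) / (n + β + η) * M n := by
      rw [div_mul_eq_mul_div, eq_div_iff (by positivity)]; linarith
    have hfac : (α + n + 1) / (n + 1) * ((n + β) / (n + β + η)) ≤ 1 := by
      rw [div_mul_div_comm, div_le_one (by positivity)]
      nlinarith [mul_nonneg hn0 (sub_nonneg.2 hαη), mul_nonneg hη.le (sub_nonneg.2 hβ1),
        mul_nonneg hβ.le (sub_nonneg.2 hαη)]
    calc _ = (α + n + 1) / (n + 1) * ((n + β) / (n + β + η)) * (laguerreWeight α n * M n) := by
          rw [e1, e2]; ring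
      _ ≤ 1 * (laguerreWeight α n * M n) :=
          mul_le_mul_of_nonneg_right hfac (mul_nonneg hg.le (hM _))
      _ = _ := one_mul _

/-! ### Algebra of a quaternionic slice -/

theorem re_eq_zero_of_mul_self {I : ℍ[ℝ]} (hI : I * I = -1) : I.re = 0 := by
  have h0 := congrArg QuaternionAlgebra.re hI
  have h1 := congrArg QuaternionAlgebra.imI hI
  have h2 := congrArg QuaternionAlgebra.imJ hI
  have h3 := congrArg QuaternionAlgebra.imK hI
  simp only [Quaternion.re_mul, Quaternion.imI_mul, Quaternion.imJ_mul, Quaternion.imK_mul,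
    Quaternion.re_neg, Quaternion.imI_neg, Quaternion.imJ_neg, Quaternion.imK_neg,
    Quaternion.re_one, Quaternion.imI_one, Quaternion.imJ_one, Quaternion.imK_one] at h0 h1 h2 h3
  by_contra h
  have e1 : I.imI = 0 := by
    have : I.re * I.imI = 0 := by linarith
    simpa [h] using this
  have e2 : I.imJ = 0 := by
    have : I.re * I.imJ = 0 := by linarith
    simpa [h] using this
  have e3 : I.imK = 0 := by
    have : I.re * I.imK = 0 := by linarith
    simpa [h] using this
  rw [e1, e2, e3] at h0
  nlinarith [mul_self_nonneg I.re]

theorem star_slice {I : ℍ[ℝ]} (hI : I * I = -1) (z : ℂ) :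
    star (slice I z) = slice I (starRingEnd ℂ z) := by
  have h := re_eq_zero_of_mul_self hI
  ext <;> simp [slice, h, mul_comm]

theorem slice_eq_liftAux {I : ℍ[ℝ]} (hI : I * I = -1) (z : ℂ) :
    slice I z = Complex.liftAux I hI z := by
  rw [Complex.liftAux_apply, slice, Quaternion.coe_mul_eq_smul]
  rfl

theorem slice_mul {I : ℍ[ℝ]} (hI : I * I = -1) (z w : ℂ) :
    slice I (z * w) = slice I z * slice I w := by
  simp only [slice_eq_liftAux hI, map_mul]

theorem slice_pow {I : ℍ[ℝ]} (hI : I * I = -1) (z : ℂ) (n : ℕ) :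
    slice I (z ^ n) = slice I z ^ n := by
  simp only [slice_eq_liftAux hI, map_pow]

theorem slice_ofReal (I : ℍ[ℝ]) (r : ℝ) : slice I (r : ℂ) = (r : ℍ[ℝ]) := by
  simp [slice]

theorem norm_slice {I : ℍ[ℝ]} (hI : I * I = -1) (z : ℂ) : ‖slice I z‖ = ‖z‖ := by
  have h : ‖slice I z‖ * ‖slice I z‖ = ‖z‖ * ‖z‖ := by
    nth_rw 2 [← norm_star]
    rw [← norm_mul, star_slice hI, ← slice_mul hI, Complex.mul_conj, slice_ofReal,
      Quaternion.norm_coe, Complex.normSq_eq_norm_sq, Real.norm_of_nonneg (sq_nonneg _), sq]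
  exact (mul_self_inj (norm_nonneg _) (norm_nonneg _)).1 h

theorem continuous_slice (I : ℍ[ℝ]) : Continuous (slice I) :=
  (Quaternion.continuous_coe.comp Complex.continuous_re).add
    ((Quaternion.continuous_coe.comp Complex.continuous_im).mul continuous_const)

/-- Since the real part is cyclic, `u` and `v` enter only through `conj v * u`. A rotation of the
disc therefore acts on inner products of monomials by a phase. -/
theorem inner_slice_mul {I : ℍ[ℝ]} (hI : I * I = -1) (u v : ℂ) (b c : ℍ[ℝ]) :
    inner ℝ (slice I u * b) (slice I v * c) =
      (starRingEnd ℂ v * u).re * (b * star c).re +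
        (starRingEnd ℂ v * u).im * (I * (b * star c)).re := by
  have hcomm : ∀ p q : ℍ[ℝ], (p * q).re = (q * p).re := fun p q => by
    simp only [Quaternion.re_mul]; ring
  rw [Quaternion.inner_def, star_mul, star_slice hI, ← mul_assoc, hcomm, ← mul_assoc, ← mul_assoc,
    ← slice_mul hI, mul_assoc, slice, add_mul, mul_assoc, Quaternion.coe_mul_eq_smul,
    Quaternion.coe_mul_eq_smul]
  simp

/-! ### Moments of the weight on the disc -/

/-- The measure `ω_{β,η}(|z|²) dx dy` on the unit disc. -/
def discMeasure (β η : ℝ) : Measure ℂ :=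
  (volume.restrict (Metric.ball (0 : ℂ) 1)).withDensity
    fun z => ENNReal.ofReal (weight β η (‖z‖ ^ 2))

theorem weight_nonneg (β η : ℝ) {t : ℝ} (h0 : 0 ≤ t) (h1 : t ≤ 1) : 0 ≤ weight β η t :=
  mul_nonneg (Real.rpow_nonneg h0 _) (Real.rpow_nonneg (by linarith) _)

theorem measurable_weight (β η : ℝ) : Measurable (weight β η) := by
  unfold weight
  fun_prop

theorem weight_norm_nonneg (β η : ℝ) {z : ℂ} (hz : z ∈ Metric.ball (0 : ℂ) 1) :
    0 ≤ weight β η (‖z‖ ^ 2) := by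
  rw [mem_ball_zero_iff] at hz
  exact weight_nonneg β η (sq_nonneg _) (pow_le_one₀ (norm_nonneg _) hz.le)

theorem integral_discMeasure {E : Type*} [NormedAddCommGroup E] [NormedSpace ℝ E]
    (β η : ℝ) (f : ℂ → E) : ∫ z, f z ∂(discMeasure β η) =
      ∫ z in Metric.ball (0 : ℂ) 1, weight β η (‖z‖ ^ 2) • f z := by
  have hm := measurable_weight β η
  rw [discMeasure, integral_withDensity_eq_integral_toReal_smul (by fun_prop) (by simp)]
  refine setIntegral_congr_fun Metric.isOpen_ball.measurableSet fun z hz => ?_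
  rw [ENNReal.toReal_ofReal (weight_norm_nonneg β η hz)]

/-- The moments of the weight on the unit disc. -/
def discMoment (β η : ℝ) (n : ℕ) : ℝ :=
  ∫ z in Metric.ball (0 : ℂ) 1, weight β η (‖z‖ ^ 2) * ‖z‖ ^ (2 * n)

theorem integrable_betaPDFReal {a b : ℝ} (ha : 0 < a) (hb : 0 < b) :
    Integrable (ProbabilityTheory.betaPDFReal a b) := by
  refine ⟨(ProbabilityTheory.measurable_betaPDFReal a b).aestronglyMeasurable, ?_⟩
  rw [hasFiniteIntegral_iff_ofReal (Filter.Eventually.of_forall fun x => ?_)]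
  · have := ProbabilityTheory.lintegral_betaPDF_eq_one ha hb
    unfold ProbabilityTheory.betaPDF at this
    rw [this]
    exact ENNReal.one_lt_top
  · by_cases hx : 0 < x ∧ x < 1
    · exact (ProbabilityTheory.betaPDFReal_pos hx.1 hx.2 ha hb).le
    · simp [ProbabilityTheory.betaPDFReal, hx]

theorem integral_betaPDFReal {a b : ℝ} (ha : 0 < a) (hb : 0 < b) :
    ∫ x, ProbabilityTheory.betaPDFReal a b x = 1 := by
  rw [integral_eq_lintegral_of_nonneg_ae (Filter.Eventually.of_forall fun x => ?_)
    (ProbabilityTheory.measurable_betaPDFReal a b).aestronglyMeasurable]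
  · have := ProbabilityTheory.lintegral_betaPDF_eq_one ha hb
    unfold ProbabilityTheory.betaPDF at this
    rw [this, ENNReal.toReal_one]
  · by_cases hx : 0 < x ∧ x < 1
    · exact (ProbabilityTheory.betaPDFReal_pos hx.1 hx.2 ha hb).le
    · simp [ProbabilityTheory.betaPDFReal, hx]

theorem weight_mul_pow_eq_betaPDFReal {β η : ℝ} (hβ : 0 < β) (hη : 0 < η) (n : ℕ) {z : ℂ}
    (hz0 : z ≠ 0) :
    (Metric.ball (0 : ℂ) 1).indicator
      (fun z => weight β η (‖z‖ ^ 2) * ‖z‖ ^ (2 * n)) z =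
      ProbabilityTheory.beta (n + β) η * ProbabilityTheory.betaPDFReal (n + β) η (‖z‖ ^ 2) := by
  have hp : 0 < ‖z‖ ^ 2 := by positivity
  have hn : (0 : ℝ) ≤ n := n.cast_nonneg
  have hb := (ProbabilityTheory.beta_pos (by linarith : 0 < n + β) hη).ne'
  by_cases hz : ‖z‖ < 1
  · have hlt : ‖z‖ ^ 2 < 1 := pow_lt_one₀ (norm_nonneg _) hz two_ne_zero
    rw [indicator_of_mem (by simpa using hz), ProbabilityTheory.betaPDFReal, if_pos ⟨hp, hlt⟩,
      weight, pow_mul, show (n + β - 1 : ℝ) = n + (β - 1) by ring, Real.rpow_add hp,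
      Real.rpow_natCast]
    field_simp
  · have hge : ¬ ‖z‖ ^ 2 < 1 := by
      rw [not_lt] at hz ⊢
      exact one_le_pow₀ hz
    rw [indicator_of_notMem (by simpa using hz), ProbabilityTheory.betaPDFReal,
      if_neg (fun h => hge h.2), mul_zero]

theorem indicator_weight_ae_eq {β η : ℝ} (hβ : 0 < β) (hη : 0 < η) (n : ℕ) :
    (Metric.ball (0 : ℂ) 1).indicator (fun z => weight β η (‖z‖ ^ 2) * ‖z‖ ^ (2 * n)) =ᵐ[volume]
      fun z => (fun r : ℝ => ProbabilityTheory.beta (n + β) η *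
        ProbabilityTheory.betaPDFReal (n + β) η (r ^ 2)) ‖z‖ := by
  -- The origin is left out: the beta density is zero there, while `0 ^ 0 = 1` can make the weight
  -- nonzero.
  filter_upwards [compl_mem_ae_iff.2 (measure_singleton (0 : ℂ))] with z hz
  exact weight_mul_pow_eq_betaPDFReal hβ hη n hz

theorem rpow_two_smul (f : ℝ → ℝ) (r : ℝ) :
    ((2 : ℝ) * r ^ ((2 : ℝ) - 1)) • f (r ^ (2 : ℝ)) = 2 * (r * f (r ^ 2)) := by
  rw [show (2 : ℝ) - 1 = 1 by norm_num, Real.rpow_one, Real.rpow_two, smul_eq_mul, mul_assoc]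

theorem integrableOn_weight_mul_pow {β η : ℝ} (hβ : 0 < β) (hη : 0 < η) (n : ℕ) :
    IntegrableOn (fun z : ℂ => weight β η (‖z‖ ^ 2) * ‖z‖ ^ (2 * n)) (Metric.ball 0 1) := by
  have hn : (0 : ℝ) < n + β := by have : (0 : ℝ) ≤ n := n.cast_nonneg; linarith
  rw [← integrable_indicator_iff Metric.isOpen_ball.measurableSet,
    integrable_congr (indicator_weight_ae_eq hβ hη n),
    integrable_fun_norm_addHaar volume (f := fun r : ℝ => ProbabilityTheory.beta (n + β) η *
      ProbabilityTheory.betaPDFReal (n + β) η (r ^ 2)),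
    Complex.finrank_real_complex]
  have h := ((integrableOn_Ioi_comp_rpow_iff (ProbabilityTheory.betaPDFReal (n + β) η)
    (two_ne_zero (α := ℝ))).2 (integrable_betaPDFReal hn hη).integrableOn).const_mul
      (ProbabilityTheory.beta (n + β) η / 2)
  refine IntegrableOn.congr_fun (s := Ioi 0) h (fun r _ => ?_) measurableSet_Ioi
  simp only [abs_two, rpow_two_smul]
  simp
  ring

/-- Polar coordinates and the substitution `t = r²` reduce the moment to a beta integral, whose
value is the normalization of the beta density. -/
theorem discMoment_eq {β η : ℝ} (hβ : 0 < β) (hη : 0 < η) (n : ℕ) :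
    discMoment β η n = Real.pi * ProbabilityTheory.beta (n + β) η := by
  have hn : (0 : ℝ) < n + β := by have : (0 : ℝ) ≤ n := n.cast_nonneg; linarith
  rw [discMoment, ← integral_indicator Metric.isOpen_ball.measurableSet,
    integral_congr_ae (indicator_weight_ae_eq hβ hη n),
    integral_fun_norm_addHaar volume (fun r : ℝ => ProbabilityTheory.beta (n + β) η *
      ProbabilityTheory.betaPDFReal (n + β) η (r ^ 2)),
    Complex.finrank_real_complex]
  have h := integral_comp_rpow_Ioi_of_pos (g := ProbabilityTheory.betaPDFReal (n + β) η)
    (two_pos (α := ℝ))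
  have h1 : ∫ x in Ioi (0 : ℝ), ProbabilityTheory.betaPDFReal (n + β) η x = 1 := by
    rw [← integral_betaPDFReal hn hη]
    apply setIntegral_eq_integral_of_forall_compl_eq_zero
    intro x hx
    rw [ProbabilityTheory.betaPDFReal, if_neg (fun h => hx h.1)]
  simp only [rpow_two_smul] at h
  rw [h1, integral_const_mul] at h
  have hv : (volume : Measure ℂ).real (Metric.ball 0 1) = Real.pi := by
    simp [Measure.real, Complex.volume_ball]
  rw [hv]
  have e : ∀ r : ℝ, r ^ (2 - 1) • (ProbabilityTheory.beta (n + β) η *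
      ProbabilityTheory.betaPDFReal (n + β) η (r ^ 2)) =
      ProbabilityTheory.beta (n + β) η *
        (r * ProbabilityTheory.betaPDFReal (n + β) η (r ^ 2)) := fun r => by
    simp; ring
  simp only [e]
  rw [integral_const_mul]
  simp only [nsmul_eq_mul, smul_eq_mul, Nat.cast_ofNat]
  linear_combination Real.pi * ProbabilityTheory.beta (n + β) η * h

theorem discMoment_nonneg {β η : ℝ} (n : ℕ) : 0 ≤ discMoment β η n :=
  setIntegral_nonneg Metric.isOpen_ball.measurableSet fun _ hz =>
    mul_nonneg (weight_norm_nonneg β η hz) (by positivity)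

theorem discMoment_recurrence {β η : ℝ} (hβ : 0 < β) (hη : 0 < η) (n : ℕ) :
    (n + β + η) * discMoment β η (n + 1) = (n + β) * discMoment β η n := by
  have hn : (0 : ℝ) < n + β := by have : (0 : ℝ) ≤ n := n.cast_nonneg; linarith
  have hn' : (0 : ℝ) < n + β + η := by linarith
  have h1 : Real.Gamma ((n + 1 : ℕ) + β) = (n + β) * Real.Gamma (n + β) := by
    rw [← Real.Gamma_add_one hn.ne']; congr 1; push_cast; ring
  have h2 : Real.Gamma ((n + 1 : ℕ) + β + η) = (n + β + η) * Real.Gamma (n + β + η) := by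
    rw [← Real.Gamma_add_one hn'.ne']; congr 1; push_cast; ring
  have h3 := (Real.Gamma_pos_of_pos hn').ne'
  rw [discMoment_eq hβ hη, discMoment_eq hβ hη, ProbabilityTheory.beta, ProbabilityTheory.beta,
    h1, h2]
  field_simp

theorem discMoment_anti {β γ η : ℝ} (hγ : 0 < γ) (hγβ : γ ≤ β) (hη : 0 < η) (n : ℕ) :
    discMoment β η n ≤ discMoment γ η n := by
  refine setIntegral_mono_ae_restrict (integrableOn_weight_mul_pow (hγ.trans_le hγβ) hη n)
    (integrableOn_weight_mul_pow hγ hη n) ?_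
  have h0 : ∀ᵐ z : ℂ ∂(volume.restrict (Metric.ball 0 1)), z ≠ 0 :=
    ae_restrict_of_ae (compl_mem_ae_iff.2 (measure_singleton (0 : ℂ)))
  filter_upwards [h0, ae_restrict_mem Metric.isOpen_ball.measurableSet] with z hz0 hz
  rw [mem_ball_zero_iff] at hz
  have hle : ‖z‖ ^ 2 ≤ 1 := pow_le_one₀ (norm_nonneg _) hz.le
  have hp : 0 < ‖z‖ ^ 2 := by positivity
  refine mul_le_mul_of_nonneg_right (mul_le_mul_of_nonneg_right
    (Real.rpow_le_rpow_of_exponent_ge hp hle (by linarith))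
    (Real.rpow_nonneg (by linarith) _)) (by positivity)

theorem isFiniteMeasure_discMeasure {β η : ℝ} (hβ : 0 < β) (hη : 0 < η) :
    IsFiniteMeasure (discMeasure β η) := by
  have h := integrableOn_weight_mul_pow hβ hη 0
  simp only [mul_zero, pow_zero, mul_one] at h
  exact isFiniteMeasure_withDensity_ofReal h.2

theorem ae_discMeasure_norm_lt (β η : ℝ) : ∀ᵐ z ∂(discMeasure β η), ‖z‖ < 1 := by
  refine (withDensity_absolutelyContinuous _ _).ae_le ?_
  filter_upwards [ae_restrict_mem Metric.isOpen_ball.measurableSet] with z hz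
  simpa using hz

/-! ### Orthogonality of monomials on the disc -/

/-- A function on the disc that changes sign under some rotation has mean zero. -/
theorem integral_discMeasure_eq_zero (β η : ℝ) (c : Circle) {f : ℂ → ℝ}
    (hf : ∀ z, f (c * z) = -f z) : ∫ z, f z ∂(discMeasure β η) = 0 := by
  rw [integral_discMeasure]
  have hmp := (rotation c).measurePreserving
  have h := hmp.setIntegral_preimage_emb (rotation c).toHomeomorph.measurableEmbedding
    (fun z => weight β η (‖z‖ ^ 2) • f z) (Metric.ball 0 1)
  have hball : (rotation c) ⁻¹' (Metric.ball (0 : ℂ) 1) = Metric.ball 0 1 := by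
    ext z
    simp only [mem_preimage, mem_ball_zero_iff, LinearIsometryEquiv.norm_map]
  rw [hball] at h
  simp only [LinearIsometryEquiv.norm_map] at h
  simp only [rotation_apply, hf, smul_neg] at h
  rw [integral_neg] at h
  linarith

theorem integral_inner_monomial_eq_zero {I : ℍ[ℝ]} (hI : I * I = -1) (β η : ℝ) {m n : ℕ}
    (hmn : m ≠ n) (b c : ℍ[ℝ]) :
    ∫ z, inner ℝ (slice I z ^ m * b) (slice I z ^ n * c) ∂(discMeasure β η) = 0 := by
  have hmn' : ((m : ℝ) - n) ≠ 0 := sub_ne_zero.2 (by exact_mod_cast hmn)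
  -- Rotation by this angle multiplies `conj(z^n) z^m` by `e^{i(m-n)θ} = -1`.
  set θ : ℝ := Real.pi / (m - n)
  refine integral_discMeasure_eq_zero β η (Circle.exp θ) fun z => ?_
  have hexp : starRingEnd ℂ ((Circle.exp θ : ℂ) ^ n) * (Circle.exp θ : ℂ) ^ m = -1 := by
    rw [Circle.coe_exp, ← Complex.exp_nat_mul, ← Complex.exp_nat_mul, ← Complex.exp_conj,
      ← Complex.exp_add]
    have : starRingEnd ℂ (n * (θ * Complex.I)) + m * (θ * Complex.I) = Real.pi * Complex.I := by
      have h1 : ((m : ℝ) - n) * θ = Real.pi := mul_div_cancel₀ _ hmn'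
      simp only [map_mul, Complex.conj_ofReal, Complex.conj_I, map_natCast]
      rw [← h1]
      push_cast
      ring
    rw [this, Complex.exp_pi_mul_I]
  have key : starRingEnd ℂ ((Circle.exp θ * z) ^ n) * (Circle.exp θ * z) ^ m =
      -(starRingEnd ℂ (z ^ n) * z ^ m) := by
    rw [mul_pow, mul_pow, map_mul]
    linear_combination (starRingEnd ℂ (z ^ n) * z ^ m) * hexp
  simp only [← slice_pow hI, inner_slice_mul hI, key, Complex.neg_re, Complex.neg_im]
  ring

theorem integral_norm_sum_monomial_sq {I : ℍ[ℝ]} (hI : I * I = -1) {β η : ℝ} (hβ : 0 < β)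
    (hη : 0 < η) (b : ℕ → ℍ[ℝ]) (s : Finset ℕ) :
    ∫ z, ‖∑ n ∈ s, slice I z ^ n * b n‖ ^ 2 ∂(discMeasure β η) =
      ∑ n ∈ s, ‖b n‖ ^ 2 * discMoment β η n := by
  have := isFiniteMeasure_discMeasure hβ hη
  have hc : ∀ n, Continuous fun z => slice I z ^ n * b n := fun n =>
    ((continuous_slice I).pow n).mul continuous_const
  have hint : ∀ m n, Integrable (fun z => inner ℝ (slice I z ^ m * b m) (slice I z ^ n * b n))
      (discMeasure β η) := by
    intro m n
    refine Integrable.of_bound ((hc m).inner (hc n)).aestronglyMeasurable (‖b m‖ * ‖b n‖) ?_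
    filter_upwards [ae_discMeasure_norm_lt β η] with z hz
    refine (norm_inner_le_norm _ _).trans ?_
    have hk : ∀ k, ‖slice I z ^ k * b k‖ ≤ ‖b k‖ := fun k => by
      rw [norm_mul, norm_pow, norm_slice hI]
      exact mul_le_of_le_one_left (norm_nonneg _) (pow_le_one₀ (norm_nonneg _) hz.le)
    exact mul_le_mul (hk m) (hk n) (norm_nonneg _) (norm_nonneg _)
  simp only [← real_inner_self_eq_norm_sq (∑ n ∈ s, _), sum_inner, inner_sum]
  rw [integral_finsetSum _ fun m _ => integrable_finsetSum _ fun n _ => hint _ _]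
  refine Finset.sum_congr rfl fun m hm => ?_
  rw [integral_finsetSum _ fun n _ => hint _ _, Finset.sum_eq_single m]
  · simp only [real_inner_self_eq_norm_sq, norm_mul, norm_pow, norm_slice hI]
    rw [integral_discMeasure, discMoment, ← integral_const_mul]
    refine integral_congr_ae (Filter.Eventually.of_forall fun z => ?_)
    simp only [smul_eq_mul]
    ring
  · intro n _ hn
    exact integral_inner_monomial_eq_zero hI β η (by tauto) _ _
  · exact fun h => absurd hm h

/-! ### Series expansion of the quaternionic kernel and of the transform -/

/-- Absolute convergence is required on the whole quaternionic ball, not only on the slice of `I`.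
The given `I` serves as the unit for real `q`, which lies in every slice. -/
theorem exists_slice_eq {I : ℍ[ℝ]} (hI : I * I = -1) (q : ℍ[ℝ]) :
    ∃ J : ℍ[ℝ], J * J = -1 ∧ ∃ z : ℂ, slice J z = q := by
  by_cases h : q.im = 0
  · refine ⟨I, hI, (q.re : ℂ), ?_⟩
    rw [slice_ofReal]
    conv_rhs => rw [← Quaternion.re_add_im q, h, add_zero]
  · have hn : ‖q.im‖ ≠ 0 := norm_ne_zero_iff.2 h
    refine ⟨‖q.im‖⁻¹ • q.im, ?_, ⟨q.re, ‖q.im‖⟩, ?_⟩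
    · have h1 : q.im * q.im = -((‖q.im‖ * ‖q.im‖ : ℝ) : ℍ[ℝ]) := by
        have hs : star q.im = -q.im := by ext <;> simp
        rw [← Quaternion.normSq_eq_norm_mul_self, ← Quaternion.self_mul_star, hs, mul_neg, neg_neg]
      rw [smul_mul_smul_comm, h1, smul_neg, ← Quaternion.coe_smul, smul_eq_mul,
        show ‖q.im‖⁻¹ * ‖q.im‖⁻¹ * (‖q.im‖ * ‖q.im‖) = 1 by field_simp, Quaternion.coe_one]
    · rw [slice, Quaternion.coe_mul_eq_smul, smul_smul, mul_inv_cancel₀ hn, one_smul,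
        Quaternion.re_add_im]

/-- The Hille–Hardy formula for quaternions. -/
theorem hasSum_kernel {α : ℝ} (hα : -1 < α) {I : ℍ[ℝ]} (hI : I * I = -1) (x y : ℝ) {q : ℍ[ℝ]}
    (hq : ‖q‖ < 1) :
    HasSum (fun n : ℕ => (laguerreFun α n x * laguerreFun α n y) • q ^ n) (kernel α x y q) := by
  obtain ⟨J, hJ, z, rfl⟩ := exists_slice_eq hI q
  rw [norm_slice hJ] at hq
  rw [kernel, sliceExt_slice _ _ _ hJ (kernelC_conj α x y z hq)]
  have hc : Continuous (Complex.liftAux J hJ) := by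
    have : ⇑(Complex.liftAux J hJ) = slice J := funext fun z => (slice_eq_liftAux hJ z).symm
    rw [this]
    exact continuous_slice J
  have h := (hasSum_kernelC hα x y hq).map (Complex.liftAux J hJ) hc
  rw [← slice_eq_liftAux hJ] at h
  have he : (fun n : ℕ => (laguerreFun α n x * laguerreFun α n y) • slice J z ^ n) =
      Complex.liftAux J hJ ∘ fun n : ℕ => ((laguerreWeight α n * (scaledLaguerre α n).eval x *
        (scaledLaguerre α n).eval y : ℝ) : ℂ) * z ^ n := by
    funext n
    rw [Function.comp_apply, ← slice_eq_liftAux hJ, slice_mul hJ, slice_ofReal, slice_pow hJ,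
      Quaternion.coe_mul_eq_smul, laguerreFun_mul hα]
  rw [he]
  exact h

/-- From `2|e_n| ≤ 1 + e_n²`: the geometric series and the Hille–Hardy series on the diagonal both
converge. -/
theorem summable_abs_laguerreFun_mul_pow {α : ℝ} (hα : -1 < α) (y : ℝ) {r : ℝ} (hr : 0 ≤ r)
    (hr1 : r < 1) : Summable fun n : ℕ => |laguerreFun α n y| * r ^ n := by
  have h := (hasSum_kernelC hα y y (z := (r : ℂ))
    (by rwa [Complex.norm_real, Real.norm_of_nonneg hr])).summable.norm
  refine Summable.of_nonneg_of_le (fun n => by positivity) (fun n => ?_)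
    (((summable_geometric_of_lt_one hr hr1).add h).div_const 2)
  rw [norm_mul, norm_pow, Complex.norm_real, Complex.norm_real, Real.norm_of_nonneg hr,
    ← laguerreFun_mul hα, Real.norm_eq_abs, abs_mul]
  nlinarith [mul_nonneg (pow_nonneg hr n) (sq_nonneg (|laguerreFun α n y| - 1))]

/-- A pointwise sum of functions whose `L¹` norms are summable is integrable. -/
theorem integrable_of_hasSum {X E : Type*} [MeasurableSpace X] {μ : Measure X}
    [NormedAddCommGroup E] {F : ℕ → X → E} {f : X → E} (hF : ∀ n, Integrable (F n) μ)
    (hs : Summable fun n => ∫ x, ‖F n x‖ ∂μ) (hf : ∀ x, HasSum (fun n => F n x) (f x)) :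
    Integrable f μ := by
  have hm : AEStronglyMeasurable f μ :=
    aestronglyMeasurable_of_tendsto_ae Filter.atTop
      (f := fun N x => ∑ n ∈ Finset.range N, F n x)
      (fun N => (integrable_finsetSum _ fun n _ => hF n).aestronglyMeasurable)
      (Filter.Eventually.of_forall fun x => (hf x).tendsto_sum_nat)
  refine ⟨hm, ?_⟩
  have hle : ∫⁻ x, ‖f x‖ₑ ∂μ ≤ ∑' n, ENNReal.ofReal (∫ x, ‖F n x‖ ∂μ) := by
    calc ∫⁻ x, ‖f x‖ₑ ∂μ ≤ ∫⁻ x, ∑' n, ‖F n x‖ₑ ∂μ := by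
          refine lintegral_mono fun x => ?_
          refine le_of_tendsto ((hf x).tendsto_sum_nat.enorm) (Filter.Eventually.of_forall
            fun N => ?_)
          exact (enorm_sum_le _ _).trans (ENNReal.sum_le_tsum _)
      _ = ∑' n, ∫⁻ x, ‖F n x‖ₑ ∂μ := lintegral_tsum fun n => (hF n).aestronglyMeasurable.enorm
      _ = _ := tsum_congr fun n => (ofReal_integral_norm_eq_lintegral_enorm (hF n)).symm
  refine hle.trans_lt ?_
  rw [← ENNReal.ofReal_tsum_of_nonneg (fun n => integral_nonneg fun _ => norm_nonneg _) hs]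
  exact ENNReal.ofReal_lt_top

/-- The coefficient of a function with respect to a Laguerre polynomial. -/
def laguerreCoeff (α : ℝ) (φ : ℝ → ℍ[ℝ]) (n : ℕ) : ℍ[ℝ] :=
  ∫ x, laguerreFun α n x • φ x ∂(laguerreMeasure α)

theorem integral_norm_laguerreFun_smul_le {α : ℝ} (hα : -1 < α) {φ : ℝ → ℍ[ℝ]}
    (hφ : MemLp φ 2 (laguerreMeasure α)) (n : ℕ) :
    ∫ x, ‖laguerreFun α n x • φ x‖ ∂(laguerreMeasure α) ≤
      (1 + ∫ x, ‖φ x‖ ^ 2 ∂(laguerreMeasure α)) / 2 := by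
  have h1 := integral_laguerreFun_mul hα n n
  rw [if_pos rfl] at h1
  have hi1 : Integrable (fun x => laguerreFun α n x * laguerreFun α n x) (laguerreMeasure α) :=
    (memLp_laguerreFun hα n).integrable_mul (memLp_laguerreFun hα n)
  have hi2 : Integrable (fun x => ‖φ x‖ ^ 2) (laguerreMeasure α) :=
    hφ.integrable_norm_pow two_ne_zero
  rw [← h1, ← integral_add hi1 hi2, ← integral_div]
  refine integral_mono (integrable_smul_of_memLp_two (memLp_laguerreFun hα n) hφ).norm
    ((hi1.add hi2).div_const 2) fun x => ?_
  simp only [norm_smul, Real.norm_eq_abs]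
  nlinarith [sq_nonneg (|laguerreFun α n x| - ‖φ x‖), abs_mul_abs_self (laguerreFun α n x)]

/-- The `L¹` norms of `e_n φ` are bounded uniformly in `n` and `|e_n(y)| ‖q‖^n` is summable, so the
kernel series may be integrated term by term. -/
theorem dualTransform_aux {α : ℝ} (hα : -1 < α) {I : ℍ[ℝ]} (hI : I * I = -1) (y : ℝ)
    {φ : ℝ → ℍ[ℝ]} (hφ : MemLp φ 2 (laguerreMeasure α)) {q : ℍ[ℝ]} (hq : ‖q‖ < 1) :
    Integrable (fun x => kernel α x y q * φ x) (laguerreMeasure α) ∧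
      HasSum (fun n : ℕ => q ^ n * (laguerreFun α n y • laguerreCoeff α φ n))
        (dualTransform α y φ q) := by
  have hi : ∀ n, Integrable (fun x => laguerreFun α n x • φ x) (laguerreMeasure α) := fun n =>
    integrable_smul_of_memLp_two (memLp_laguerreFun hα n) hφ
  set F : ℕ → ℝ → ℍ[ℝ] := fun n x =>
    (q ^ n * (laguerreFun α n y : ℍ[ℝ])) * (laguerreFun α n x • φ x) with hF
  have hFi : ∀ n, Integrable (F n) (laguerreMeasure α) := fun n => (hi n).const_mul _
  have hpt : ∀ x, HasSum (fun n => F n x) (kernel α x y q * φ x) := fun x => by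
    have h := (hasSum_kernel hα hI x y hq).mul_right (φ x)
    refine Eq.mp (congrArg (HasSum · _) (funext fun n => ?_)) h
    change _ = q ^ n * (laguerreFun α n y : ℍ[ℝ]) * (laguerreFun α n x • φ x)
    rw [Quaternion.mul_coe_eq_smul, smul_mul_assoc, mul_smul_comm, smul_mul_assoc, smul_smul]
  have hsum : Summable fun n => ∫ x, ‖F n x‖ ∂(laguerreMeasure α) := by
    refine Summable.of_nonneg_of_le (fun n => integral_nonneg fun _ => norm_nonneg _) (fun n => ?_)
      ((summable_abs_laguerreFun_mul_pow hα y (norm_nonneg q) hq).mul_right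
        ((1 + ∫ x, ‖φ x‖ ^ 2 ∂(laguerreMeasure α)) / 2))
    simp only [hF, norm_mul (_ * _ : ℍ[ℝ])]
    rw [integral_const_mul, norm_mul, norm_pow, Quaternion.norm_coe, Real.norm_eq_abs,
      mul_comm (‖q‖ ^ n)]
    exact mul_le_mul_of_nonneg_left (integral_norm_laguerreFun_smul_le hα hφ n) (by positivity)
  refine ⟨integrable_of_hasSum hFi hsum hpt, ?_⟩
  have h := hasSum_integral_of_summable_integral_norm hFi hsum
  have e1 : (∫ x, ∑' n, F n x ∂(laguerreMeasure α)) = dualTransform α y φ q :=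
    integral_congr_ae (Filter.Eventually.of_forall fun x => (hpt x).tsum_eq)
  rw [e1] at h
  refine Eq.mp (congrArg (HasSum · _) (funext fun n => ?_)) h
  simp only [hF]
  rw [laguerreCoeff, ← Quaternion.coe_mul_eq_smul, ← mul_assoc]
  exact ((ContinuousLinearMap.mul ℝ ℍ[ℝ]) _).integral_comp_comm (hi n)

/-! ### The `L²` bound and the operator -/

theorem ae_sliceMeasure_norm_lt {I : ℍ[ℝ]} (hI : I * I = -1) (β η : ℝ) :
    ∀ᵐ q ∂(sliceMeasure I β η), ‖q‖ < 1 := by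
  change ∀ᵐ q ∂((discMeasure β η).map (slice I)), ‖q‖ < 1
  rw [ae_map_iff (measurable_slice I).aemeasurable
    (isOpen_lt continuous_norm continuous_const).measurableSet]
  simpa only [norm_slice hI] using ae_discMeasure_norm_lt β η

theorem eLpNorm_sum_sliceMeasure {I : ℍ[ℝ]} (hI : I * I = -1) {β η : ℝ} (hβ : 0 < β)
    (hη : 0 < η) (b : ℕ → ℍ[ℝ]) (s : Finset ℕ) :
    eLpNorm (fun q => ∑ n ∈ s, q ^ n * b n) 2 (sliceMeasure I β η) =
      ENNReal.ofReal (Real.sqrt (∑ n ∈ s, ‖b n‖ ^ 2 * discMoment β η n)) := by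
  have := isFiniteMeasure_discMeasure hβ hη
  have hc : Continuous fun q : ℍ[ℝ] => ∑ n ∈ s, q ^ n * b n := by fun_prop
  change eLpNorm _ 2 ((discMeasure β η).map (slice I)) = _
  rw [eLpNorm_map_measure hc.aestronglyMeasurable (measurable_slice I).aemeasurable]
  have hm : MemLp ((fun q : ℍ[ℝ] => ∑ n ∈ s, q ^ n * b n) ∘ slice I) 2 (discMeasure β η) := by
    refine MemLp.of_bound (hc.comp (continuous_slice I)).aestronglyMeasurable (∑ n ∈ s, ‖b n‖) ?_
    filter_upwards [ae_discMeasure_norm_lt β η] with z hz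
    refine (norm_sum_le _ _).trans (Finset.sum_le_sum fun n _ => ?_)
    rw [norm_mul, norm_pow, norm_slice hI]
    exact mul_le_of_le_one_left (norm_nonneg _) (pow_le_one₀ (norm_nonneg _) hz.le)
  rw [hm.eLpNorm_eq_integral_rpow_norm two_ne_zero ENNReal.ofNat_ne_top,
    ← integral_norm_sum_monomial_sq hI hβ hη, Real.sqrt_eq_rpow]
  simp [ENNReal.toReal_ofNat]

/-- The `L²` estimate for the dual transform, given a bound for the Laguerre functions at `y`. -/
theorem memLp_dualTransform {α : ℝ} (hα : -1 < α) {I : ℍ[ℝ]} (hI : I * I = -1) {β η : ℝ}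
    (hβ : 0 < β) (hη : 0 < η) {y C : ℝ}
    (hC : ∀ n, laguerreFun α n y ^ 2 * discMoment β η n ≤ C)
    {φ : ℝ → ℍ[ℝ]} (hφ : MemLp φ 2 (laguerreMeasure α)) :
    MemLp (dualTransform α y φ) 2 (sliceMeasure I β η) ∧
      eLpNorm (dualTransform α y φ) 2 (sliceMeasure I β η) ≤
        ENNReal.ofReal (Real.sqrt (C * ∫ x, ‖φ x‖ ^ 2 ∂(laguerreMeasure α))) := by
  have hC0 : 0 ≤ C := le_trans (mul_nonneg (sq_nonneg _) (discMoment_nonneg 0)) (hC 0)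
  have hlim : ∀ᵐ q ∂(sliceMeasure I β η), Filter.Tendsto
      (fun N => ∑ n ∈ Finset.range N, q ^ n * (laguerreFun α n y • laguerreCoeff α φ n))
      Filter.atTop (nhds (dualTransform α y φ q)) := by
    filter_upwards [ae_sliceMeasure_norm_lt hI β η] with q hq
    exact (dualTransform_aux hα hI y hφ hq).2.tendsto_sum_nat
  have hm : ∀ N : ℕ, AEStronglyMeasurable (fun q : ℍ[ℝ] =>
      ∑ n ∈ Finset.range N, q ^ n * (laguerreFun α n y • laguerreCoeff α φ n))
      (sliceMeasure I β η) := fun N =>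
    Continuous.aestronglyMeasurable (by fun_prop)
  have hle : eLpNorm (dualTransform α y φ) 2 (sliceMeasure I β η) ≤
      ENNReal.ofReal (Real.sqrt (C * ∫ x, ‖φ x‖ ^ 2 ∂(laguerreMeasure α))) := by
    -- Fatou's lemma: a uniform bound on the norms of the partial sums passes to their pointwise
    -- limit.
    refine (Lp.eLpNorm_lim_le_liminf_eLpNorm hm _ hlim).trans ?_
    refine Filter.liminf_le_of_frequently_le' (Filter.Eventually.frequently
      (Filter.Eventually.of_forall fun N => ?_))
    rw [eLpNorm_sum_sliceMeasure hI hβ hη]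
    refine ENNReal.ofReal_le_ofReal (Real.sqrt_le_sqrt ?_)
    refine le_trans ?_ (mul_le_mul_of_nonneg_left (sum_norm_integral_smul_sq_le
      (memLp_laguerreFun hα) (integral_laguerreFun_mul hα) hφ (Finset.range N)) hC0)
    rw [Finset.mul_sum]
    refine Finset.sum_le_sum fun n _ => ?_
    rw [norm_smul, mul_pow, Real.norm_eq_abs, sq_abs]
    calc _ = (laguerreFun α n y ^ 2 * discMoment β η n) * ‖laguerreCoeff α φ n‖ ^ 2 := by ring
      _ ≤ _ := mul_le_mul_of_nonneg_right (hC n) (sq_nonneg _)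
  exact ⟨⟨aestronglyMeasurable_of_tendsto_ae _ hm hlim, hle.trans_lt ENNReal.ofReal_lt_top⟩, hle⟩

theorem integral_norm_sq_Lp {α : ℝ} (φ : Lp ℍ[ℝ] 2 (laguerreMeasure α)) :
    ∫ x, ‖φ x‖ ^ 2 ∂(laguerreMeasure α) = ‖φ‖ ^ 2 := by
  rw [← real_inner_self_eq_norm_sq φ, L2.inner_def]
  simp only [real_inner_self_eq_norm_sq]

theorem dualTransform_congr {α y : ℝ} {φ ψ : ℝ → ℍ[ℝ]} (h : φ =ᵐ[laguerreMeasure α] ψ) :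
    dualTransform α y φ = dualTransform α y ψ := by
  funext q
  exact integral_congr_ae (h.mono fun x hx => by simp only [hx])

theorem isBoundedDualTransform_of_le {α : ℝ} (hα : -1 < α) {I : ℍ[ℝ]} (hI : I * I = -1)
    {β η : ℝ} (hβ : 0 < β) (hη : 0 < η) {y C : ℝ}
    (hC : ∀ n, laguerreFun α n y ^ 2 * discMoment β η n ≤ C) :
    IsBoundedDualTransform α β η I y := by
  have hT := fun φ : Lp ℍ[ℝ] 2 (laguerreMeasure α) =>
    memLp_dualTransform hα hI hβ hη hC (Lp.memLp φ)
  have hint := fun (φ : Lp ℍ[ℝ] 2 (laguerreMeasure α)) (q : ℍ[ℝ]) (hq : ‖q‖ < 1) =>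
    (dualTransform_aux hα hI y (Lp.memLp φ) hq).1
  have hC0 : 0 ≤ C := le_trans (mul_nonneg (sq_nonneg _) (discMoment_nonneg 0)) (hC 0)
  let T : Lp ℍ[ℝ] 2 (laguerreMeasure α) →ₗ[(ℍ[ℝ])ᵐᵒᵖ] Lp ℍ[ℝ] 2 (sliceMeasure I β η) :=
    { toFun := fun φ => (hT φ).1.toLp
      map_add' := fun φ ψ => by
        apply Lp.ext
        filter_upwards [(hT (φ + ψ)).1.coeFn_toLp, (hT φ).1.coeFn_toLp, (hT ψ).1.coeFn_toLp,
          Lp.coeFn_add (hT φ).1.toLp (hT ψ).1.toLp, ae_sliceMeasure_norm_lt hI β η]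
          with q h1 h2 h3 h4 hq
        rw [h1, h4, Pi.add_apply, h2, h3, dualTransform_congr (Lp.coeFn_add φ ψ), dualTransform,
          dualTransform, dualTransform, ← integral_add (hint φ q hq) (hint ψ q hq)]
        simp only [Pi.add_apply, mul_add]
      map_smul' := fun c φ => by
        apply Lp.ext
        filter_upwards [(hT (c • φ)).1.coeFn_toLp, (hT φ).1.coeFn_toLp,
          Lp.coeFn_smul c (hT φ).1.toLp, ae_sliceMeasure_norm_lt hI β η] with q h1 h2 h3 hq
        rw [h1, RingHom.id_apply, h3, Pi.smul_apply, h2, dualTransform_congr (Lp.coeFn_smul c φ),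
          dualTransform, dualTransform]
        -- The kernel multiplies from the left and the scalar from the right, so the scalar leaves
        -- the integral by associativity.
        simp only [Pi.smul_apply, MulOpposite.smul_eq_mul_unop, ← mul_assoc]
        exact ((ContinuousLinearMap.mul ℝ ℍ[ℝ]).flip c.unop).integral_comp_comm (hint φ q hq) }
  have hbound : ∀ φ, ‖T φ‖ ≤ Real.sqrt C * ‖φ‖ := fun φ => by
    change ‖(hT φ).1.toLp‖ ≤ _
    rw [Lp.norm_toLp]
    refine ENNReal.toReal_le_of_le_ofReal (by positivity) ((hT φ).2.trans_eq ?_)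
    rw [integral_norm_sq_Lp, Real.sqrt_mul hC0, Real.sqrt_sq (norm_nonneg _)]
  exact ⟨hint, ⟨T, AddMonoidHomClass.continuous_of_bound T _ hbound⟩,
    fun φ => (hT φ).1.coeFn_toLp⟩

end DualHankel

end

theorem mainTheorem1 (α β η : ℝ) (hα : -1 < α) (hβ : 0 < β) (hη : 0 < η)
    (I : ℍ[ℝ]) (hI : I * I = -1) :
    (∀ y : ℝ, 0 < y → DualHankel.IsBoundedDualTransform α β η I y) ∧
    (α ≤ η → DualHankel.IsBoundedDualTransform α β η I 0) := by
  refine ⟨fun y hy => ?_, fun hαη => ?_⟩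
  · obtain ⟨C, hC⟩ := DualHankel.exists_laguerreFun_sq_mul_le hα hy hβ hη
      (fun n => DualHankel.discMoment_nonneg n) (DualHankel.discMoment_recurrence hβ hη)
    exact DualHankel.isBoundedDualTransform_of_le hα hI hβ hη hC
  -- Lowering `β` to `min β 1` only enlarges the weight on the disc, and the monotonicity argument
  -- at the origin needs an exponent at most `1`.
  · have hγ : 0 < min β 1 := lt_min hβ one_pos
    refine DualHankel.isBoundedDualTransform_of_le hα hI hβ hη fun n =>
      (mul_le_mul_of_nonneg_left (DualHankel.discMoment_anti hγ (min_le_left β 1) hη n)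
        (sq_nonneg _)).trans (DualHankel.laguerreFun_zero_sq_mul_le hα hγ (min_le_right β 1) hη hαη
          (fun n => DualHankel.discMoment_nonneg n) (DualHankel.discMoment_recurrence hγ hη) n)
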